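/- Let $d\ge 1$ and let $P\subset\mathbb R^d$ be a lattice $d$-polytope (the convex hull of finitely many points of $\mathbb Z^d$, of dimension $d$), with vertex set $V(P)$ and with exactly $k\ge 0$ lattice points in its interior. $P$ is called clean if $\partial P\cap\mathbb Z^d=V(P)$. A triangulation of a finite set $\mathcal P$ whose affine hull has dimension $j$ is a set of nondegenerate $j$-simplices such that: all their vertices lie in $\mathcal P$; their relative interiors are pairwise disjoint; each facet of a simplex either lies on the relative boundary of $\mathrm{conv}(\mathcal P)$ or is a common facet of exactly two of the simplices; no simplex contains a point of $\mathcal P$ other than its vertices; every point of $\mathcal P$ is a vertex of some simplex; and the union of the simplices is $\mathrm{conv}(\mathcal P)$. A lattice triangulation $\mathcal T$ of $P$ is a triangulation of some set $\mathcal P$ with $V(P)\subseteq\mathcal P\subseteq P\cap\mathbb Z^d$; then $V(\mathcal T)=\mathcal P$ denotes the set of all vertices of its simplices. It is full if $V(\mathcal T)=P\cap\mathbb Z^d$. For lattice triangulations of $P$, $\mathcal T\prec\mathcal T'$ ($\mathcal T'$ is a refinement of $\mathcal T$) means that $V(\mathcal T)\subsetneq V(\mathcal T')$ and every simplex of $\mathcal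 T'$ is contained in a simplex of $\mathcal T$. For $w\in\mathrm{int}(P)\cap\mathbb Z^d$, a basic triangulation of $P$ with respect to $w$ is a lattice triangulation of $P$ of the form $\{\mathrm{conv}(S\cup\{w\}) : S\in\mathcal T_F,\ F \text{ a facet of } P\}$, where each $\mathcal T_F$ is a triangulation of the vertex set $V(F)$ of the facet $F$. Put $n=\max(k,1)$ if $P$ is clean and $n=\max(k,2)$ otherwise. Then there is a sequence $\mathcal T_1\prec\cdots\prec\mathcal T_n$ of lattice triangulations of $P$ such that $\mathcal T_1$ is a basic triangulation of $P$ with respect to some interior lattice point if $k\ge1$, and a triangulation of $V(P)$ if $k=0$; $\mathcal T_n$ is a full triangulation of $P$; and $|\mathcal T_n|\ge dk+1$. Moreover, $\mathrm{Vol}(P)\ge\frac{1}{d!}(dk+1)$. -/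

import Mathlib

namespace LatticeTriang

/-- The integer lattice `ℤ^d` inside Euclidean `d`-space. -/
def latticePoints (d : ℕ) : Set (EuclideanSpace ℝ (Fin d)) :=
  {x | ∀ i, ∃ m : ℤ, x i = (m : ℝ)}

/-- A lattice `d`-polytope in `ℝ^d`: the convex hull of finitely many lattice points, of full
dimension `d`. Its vertex set is `P.extremePoints ℝ`. -/
def IsLatticePolytope {d : ℕ} (P : Set (EuclideanSpace ℝ (Fin d))) : Prop :=
  (∃ A : Set (EuclideanSpace ℝ (Fin d)), A.Finite ∧ A ⊆ latticePoints d ∧ P = convexHull ℝ A) ∧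
    affineSpan ℝ P = ⊤

/-- `P` is clean: the lattice points on its boundary are exactly its vertices. -/
def IsClean {d : ℕ} (P : Set (EuclideanSpace ℝ (Fin d))) : Prop :=
  frontier P ∩ latticePoints d = P.extremePoints ℝ

/-- A facet of a `d`-polytope `P ⊆ ℝ^d`: a `(d-1)`-dimensional intersection of `P` with a supporting
hyperplane. -/
def IsFacet {d : ℕ} (P F : Set (EuclideanSpace ℝ (Fin d))) : Prop :=
  (∃ (a : EuclideanSpace ℝ (Fin d)) (b : ℝ), a ≠ 0 ∧ (∀ x ∈ P, inner ℝ a x ≤ b) ∧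
    F = {x ∈ P | inner ℝ a x = b}) ∧
  F.Nonempty ∧ Module.finrank ℝ (vectorSpan ℝ F) + 1 = d

/-- `T` is a triangulation of the point set `A` (equivalently, of `convexHull ℝ A` with dependence
on `A` understood). A simplex is recorded by its set of vertices; the simplex itself is the convex
hull of this set. Interior and boundary are taken relative to the affine hull, so that the notion
applies to the facets of a polytope as well; for a full-dimensional set they are the usual ones. -/
structure IsTriangulation {d : ℕ} (A : Set (EuclideanSpace ℝ (Fin d)))
    (T : Finset (Finset (EuclideanSpace ℝ (Fin d)))) : Prop where
  /-- each member is a nondegenerate simplex -/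
  affineIndependent : ∀ s ∈ T, AffineIndependent ℝ ((↑) : s → EuclideanSpace ℝ (Fin d))
  /-- of the dimension of `A` -/
  card_eq : ∀ s ∈ T, s.card = Module.finrank ℝ (vectorSpan ℝ A) + 1
  /-- all vertices are members of `A` -/
  vertices_subset : ∀ s ∈ T, (s : Set (EuclideanSpace ℝ (Fin d))) ⊆ A
  /-- the interiors are pairwise disjoint -/
  disjoint_interiors : ∀ s ∈ T, ∀ t ∈ T, s ≠ t →
    Disjoint (intrinsicInterior ℝ (convexHull ℝ (s : Set (EuclideanSpace ℝ (Fin d)))))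
      (intrinsicInterior ℝ (convexHull ℝ (t : Set (EuclideanSpace ℝ (Fin d)))))
  /-- each facet of a simplex is on the boundary or is a facet of exactly two simplices -/
  facets : ∀ s ∈ T, ∀ v ∈ s,
    convexHull ℝ ((s : Set (EuclideanSpace ℝ (Fin d))) \ {v}) ⊆
        intrinsicFrontier ℝ (convexHull ℝ A) ∨
      {t : Finset (EuclideanSpace ℝ (Fin d)) | t ∈ T ∧ ∃ u ∈ t,
        (t : Set (EuclideanSpace ℝ (Fin d))) \ {u} =
          (s : Set (EuclideanSpace ℝ (Fin d))) \ {v}}.ncard = 2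
  /-- a simplex contains no points of `A` other than its vertices -/
  no_other_points : ∀ s ∈ T, convexHull ℝ (s : Set (EuclideanSpace ℝ (Fin d))) ∩ A ⊆ s
  /-- every point of `A` is a vertex of some simplex -/
  iUnion_vertices : (⋃ s ∈ T, (s : Set (EuclideanSpace ℝ (Fin d)))) = A
  /-- the simplices cover the convex hull of `A` -/
  iUnion_simplices :
    (⋃ s ∈ T, convexHull ℝ (s : Set (EuclideanSpace ℝ (Fin d)))) = convexHull ℝ A

/-- The vertex set of a triangulation: the union of all vertices of all simplices. -/
def vertexSet {d : ℕ} (T : Finset (Finset (EuclideanSpace ℝ (Fin d)))) :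
    Set (EuclideanSpace ℝ (Fin d)) :=
  ⋃ s ∈ T, (s : Set (EuclideanSpace ℝ (Fin d)))

/-- `T` is a lattice triangulation of `P`: a triangulation of some set `A` of lattice points of `P`
containing the vertices of `P`. -/
def IsLatticeTriangulation {d : ℕ} (P : Set (EuclideanSpace ℝ (Fin d)))
    (T : Finset (Finset (EuclideanSpace ℝ (Fin d)))) : Prop :=
  ∃ A : Set (EuclideanSpace ℝ (Fin d)),
    P.extremePoints ℝ ⊆ A ∧ A ⊆ P ∩ latticePoints d ∧ IsTriangulation A T

/-- `T ≺ T'`: the lattice triangulation `T'` of `P` is a refinement of the lattice triangulation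
`T` of `P`. -/
def IsRefinement {d : ℕ} (P : Set (EuclideanSpace ℝ (Fin d)))
    (T T' : Finset (Finset (EuclideanSpace ℝ (Fin d)))) : Prop :=
  IsLatticeTriangulation P T ∧ IsLatticeTriangulation P T' ∧ vertexSet T ⊂ vertexSet T' ∧
    ∀ t' ∈ T', ∃ t ∈ T, convexHull ℝ (t' : Set (EuclideanSpace ℝ (Fin d))) ⊆
      convexHull ℝ (t : Set (EuclideanSpace ℝ (Fin d)))

/-- `T` is a full lattice triangulation of `P`: every lattice point of `P` is a vertex. -/
def IsFullTriangulation {d : ℕ} (P : Set (EuclideanSpace ℝ (Fin d)))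
    (T : Finset (Finset (EuclideanSpace ℝ (Fin d)))) : Prop :=
  IsLatticeTriangulation P T ∧ vertexSet T = P ∩ latticePoints d

/-- `T` is a basic lattice triangulation of `P` with respect to the interior lattice point `w`:
a lattice triangulation consisting of the simplices `conv(S, w)`, where `S` runs over the simplices
of triangulations `𝒯 F` of the vertex sets of the facets `F` of `P`. (For an arbitrary choice of
the `𝒯 F` the cones need not fit together along the ridges of `P`; being a triangulation of `P` is
therefore part of the definition.) -/
def IsBasicTriangulation {d : ℕ} (P : Set (EuclideanSpace ℝ (Fin d)))
    (w : EuclideanSpace ℝ (Fin d)) (T : Finset (Finset (EuclideanSpace ℝ (Fin d)))) : Prop :=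
  w ∈ interior P ∩ latticePoints d ∧ IsLatticeTriangulation P T ∧
    ∃ 𝒯 : Set (EuclideanSpace ℝ (Fin d)) → Finset (Finset (EuclideanSpace ℝ (Fin d))),
      (∀ F, IsFacet P F → IsTriangulation (F.extremePoints ℝ) (𝒯 F)) ∧
      ∀ t : Finset (EuclideanSpace ℝ (Fin d)), t ∈ T ↔ ∃ F, IsFacet P F ∧ ∃ s ∈ 𝒯 F,
        (t : Set (EuclideanSpace ℝ (Fin d))) = insert w (s : Set (EuclideanSpace ℝ (Fin d)))

end LatticeTriang

/-! Triangulations are handled through `hom`, which sends a finitely supported weight on points to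
its mass and weighted sum. `IsTri` asks that nonnegative weights carried by cells agree as soon as
their images under `hom` agree. This one condition encodes both that cells are nondegenerate and
that they meet face to face. With the covering property it yields every clause of `IsTriangulation`,
and it passes easily through subdivisions.

The starting triangulation is a regular one on `V(P)`, or on `V(P)` and an interior lattice point
`w`. Its heights are generic, with the pulled point so low that every cell contains it
(`exists_pulling`). When that point is interior, the faces opposite to it lie in facets of `P` and
triangulate them (`exists_facet_of_mem`, `isTri_linkIn`), so the triangulation is basic. The other
lattice points enter by stellar subdivision (`IsTri.isTri_stellar`).

If `m` cells contain the face `F` carrying a new point, subdivision adds `m (|F| - 1)` cells. For a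
point interior to `P`, crossing the `d + 1 - |F|` facets of one such cell that contain `F` leads to
distinct cells, so `m ≥ d + 2 - |F|` (`IsTri.le_card_star`), and since `|F| ≥ 2` at least `d` cells
are added. The same bound with `F = {w}` gives a basic triangulation at least `d + 1` cells. Hence
`k ≥ 1` interior points force `d + 1 + d (k - 1) = dk + 1` cells, and boundary points never lower
the count. Each lattice simplex has volume at least `1/d!`, which gives the volume bound.

A polytope that is not clean has a boundary lattice point to spare for one more refinement; surplus
points are all inserted in the last step. -/

set_option linter.unusedSectionVars false

namespace LatticeTriang

/-! ### Weights, and affine dependence as linear dependence of `(1, a)`. -/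

section Weights

open Finsupp
open scoped Classical

variable {E : Type*} [AddCommGroup E] [Module ℝ E]

/-- The total mass of a weight function, paired with its weighted sum of points. -/
noncomputable def hom : (E →₀ ℝ) →ₗ[ℝ] ℝ × E :=
  Finsupp.linearCombination ℝ fun a => ((1 : ℝ), a)

@[simp] lemma hom_single (a : E) (r : ℝ) : hom (single a r) = (r, r • a) := by
  simp [hom]

lemma hom_eq_sum {s : Finset E} {l : E →₀ ℝ} (h : l.support ⊆ s) :
    hom l = (∑ a ∈ s, l a, ∑ a ∈ s, l a • a) := by
  rw [hom, Finsupp.linearCombination_apply, Finsupp.sum_of_support_subset _ h _ (by simp)]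
  ext <;> simp [Prod.fst_sum, Prod.snd_sum]

/-- The restriction of a function to a finite set, as a weight function. -/
noncomputable def restrictWeights (s : Finset E) (w : E → ℝ) : E →₀ ℝ :=
  Finsupp.onFinset s (fun a => if a ∈ s then w a else 0) (by
    intro a ha; by_contra h; simp [h] at ha)

@[simp] lemma restrictWeights_apply (s : Finset E) (w : E → ℝ) (a : E) :
    restrictWeights s w a = if a ∈ s then w a else 0 := rfl

lemma support_restrictWeights_subset (s : Finset E) (w : E → ℝ) :
    (restrictWeights s w).support ⊆ s := Finsupp.support_onFinset_subset

lemma hom_restrictWeights (s : Finset E) (w : E → ℝ) :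
    hom (restrictWeights s w) = (∑ a ∈ s, w a, ∑ a ∈ s, w a • a) := by
  rw [hom_eq_sum (support_restrictWeights_subset s w)]
  congr 1 <;> exact Finset.sum_congr rfl fun a ha => by simp [ha]

/-- Nonnegative weights supported on `s`. -/
structure IsWeight (s : Finset E) (l : E →₀ ℝ) : Prop where
  nonneg : ∀ a, 0 ≤ l a
  support : l.support ⊆ s

lemma IsWeight.eq_zero {s : Finset E} {l : E →₀ ℝ} (h : IsWeight s l) {a : E} (ha : a ∉ s) :
    l a = 0 := by
  by_contra h0
  exact ha (h.support (by simpa using h0))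

lemma support_subset_of_forall {s : Finset E} {l : E →₀ ℝ} (h : ∀ a, a ∉ s → l a = 0) :
    l.support ⊆ s := fun a ha => by
  by_contra h0
  exact (Finsupp.mem_support_iff.1 ha) (h a h0)

lemma IsWeight.mono {s t : Finset E} {l : E →₀ ℝ} (h : IsWeight s l) (hst : s ⊆ t) :
    IsWeight t l := ⟨h.nonneg, h.support.trans hst⟩

lemma IsWeight.add {s : Finset E} {l m : E →₀ ℝ} (hl : IsWeight s l) (hm : IsWeight s m) :
    IsWeight s (l + m) :=
  ⟨fun a => add_nonneg (hl.nonneg a) (hm.nonneg a),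
    support_subset_of_forall fun a ha => by simp [hl.eq_zero ha, hm.eq_zero ha]⟩

lemma IsWeight.smul {s : Finset E} {l : E →₀ ℝ} (hl : IsWeight s l) {c : ℝ} (hc : 0 ≤ c) :
    IsWeight s (c • l) :=
  ⟨fun a => mul_nonneg hc (hl.nonneg a),
    support_subset_of_forall fun a ha => by simp [hl.eq_zero ha]⟩

lemma isWeight_single {s : Finset E} {a : E} (ha : a ∈ s) {r : ℝ} (hr : 0 ≤ r) :
    IsWeight s (single a r) :=
  ⟨fun b => by rw [Finsupp.single_apply]; split_ifs <;> simp [hr],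
    support_subset_of_forall fun b hb => by
      rw [Finsupp.single_apply, if_neg]; rintro rfl; exact hb ha⟩

lemma mem_convexHull_iff_exists_weight {s : Finset E} {x : E} :
    x ∈ convexHull ℝ (s : Set E) ↔ ∃ l, IsWeight s l ∧ hom l = (1, x) := by
  rw [Finset.mem_convexHull']
  constructor
  · rintro ⟨w, h0, h1, hx⟩
    refine ⟨restrictWeights s w, ⟨fun a => ?_, support_restrictWeights_subset s w⟩, ?_⟩
    · rw [restrictWeights_apply]; split_ifs with ha
      exacts [h0 a ha, le_rfl]
    · rw [hom_restrictWeights, h1, hx]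
  · rintro ⟨l, hl, h⟩
    rw [hom_eq_sum hl.support, Prod.mk.injEq] at h
    exact ⟨l, fun a _ => hl.nonneg a, h.1, h.2⟩

lemma exists_of_mem_affineSpan {s : Finset E} {x : E} (hx : x ∈ affineSpan ℝ (s : Set E)) :
    ∃ l : E →₀ ℝ, l.support ⊆ s ∧ hom l = (1, x) := by
  have hsub : ∀ l : E →₀ ℝ, l.support ⊆ s ↔ l ∈ Finsupp.supported ℝ ℝ (s : Set E) := fun l => by
    rw [Finsupp.mem_supported, Finset.coe_subset]
  simp only [hsub]
  refine affineSpan_induction hx (fun a ha => ?_) fun c u v w hu hv hw => ?_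
  · exact ⟨single a 1, Finsupp.single_mem_supported ℝ _ ha, by simp⟩
  · obtain ⟨lu, hu1, hu2⟩ := hu
    obtain ⟨lv, hv1, hv2⟩ := hv
    obtain ⟨lw, hw1, hw2⟩ := hw
    refine ⟨c • (lu - lv) + lw, Submodule.add_mem _ (Submodule.smul_mem _ _
      (Submodule.sub_mem _ hu1 hv1)) hw1, ?_⟩
    simp [hu2, hv2, hw2]

lemma affineIndependent_iff_hom {s : Finset E} :
    AffineIndependent ℝ ((↑) : s → E) ↔ ∀ l : E →₀ ℝ, l.support ⊆ s → hom l = 0 → l = 0 := by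
  rw [affineIndependent_iff]
  constructor
  · intro h l hl h0
    rw [hom_eq_sum hl, Prod.mk_eq_zero] at h0
    have := h s.attach (fun a => l a) (by rw [Finset.sum_attach s fun a => l a]; exact h0.1)
      (by rw [Finset.sum_attach s fun a => l a • a]; exact h0.2)
    ext a
    by_cases ha : a ∈ s
    · exact this ⟨a, ha⟩ (Finset.mem_attach _ _)
    · by_contra h1
      exact ha (hl (by simpa using h1))
  · intro h r w h1 h2 e he
    let l : E →₀ ℝ := ∑ a ∈ r, single (a : E) (w a)
    have hl : l = 0 := by
      refine h l ?_ ?_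
      · refine support_subset_of_forall fun a ha => ?_
        simp only [l, Finsupp.finsetSum_apply]
        refine Finset.sum_eq_zero fun b _ => ?_
        rw [Finsupp.single_apply, if_neg]
        rintro rfl; exact ha b.2
      · simp only [l, map_sum, hom_single]
        ext <;> simp [Prod.fst_sum, Prod.snd_sum, h1, h2]
    have := DFunLike.congr_fun hl (e : E)
    simp only [l, Finsupp.finsetSum_apply, Finsupp.coe_zero, Pi.zero_apply] at this
    rw [Finset.sum_eq_single e] at this
    · simpa using this
    · intro b _ hb
      rw [Finsupp.single_apply, if_neg]
      exact fun h => hb (Subtype.ext h)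
    · exact fun h => absurd he h

lemma hom_eq_iff_of_affineIndependent {s : Finset E} (hs : AffineIndependent ℝ ((↑) : s → E))
    {l m : E →₀ ℝ} (hl : l.support ⊆ s) (hm : m.support ⊆ s) (h : hom l = hom m) : l = m := by
  refine sub_eq_zero.1 (affineIndependent_iff_hom.1 hs _ ?_ (by rw [map_sub, h, sub_self]))
  exact (Finsupp.support_sub).trans (Finset.union_subset hl hm)

end Weights

/-! ### Triangulations through uniqueness of weights. -/

section Tri

open Finsupp
open scoped Classical

variable {E : Type*} [NormedAddCommGroup E] [NormedSpace ℝ E] [DecidableEq E]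

/-- A face-to-face triangulation with vertex set `A`, expressed through uniqueness of
nonnegative weights supported on cells. -/
structure IsTri (A : Set E) (T : Finset (Finset E)) : Prop where
  unique : ∀ s ∈ T, ∀ t ∈ T, ∀ l m : E →₀ ℝ, IsWeight s l → IsWeight t m → hom l = hom m → l = m
  card_eq : ∀ s ∈ T, s.card = Module.finrank ℝ (vectorSpan ℝ A) + 1
  iUnion_vertices : (⋃ s ∈ T, (s : Set E)) = A
  cover : convexHull ℝ A ⊆ ⋃ s ∈ T, convexHull ℝ (s : Set E)

/-- Positive and negative parts: uniqueness of nonnegative weights thereby controls signed ones. -/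
lemma exists_sub_isWeight {s : Finset E} {l : E →₀ ℝ} (hl : l.support ⊆ s) :
    ∃ m n, IsWeight s m ∧ IsWeight s n ∧ l = m - n ∧ (m = n → l = 0) := by
  have he : l = restrictWeights s (fun a => max (l a) 0) -
      restrictWeights s fun a => max (-l a) 0 := by
    ext a
    rw [Finsupp.sub_apply, restrictWeights_apply, restrictWeights_apply]
    split_ifs with ha
    · rcases le_total 0 (l a) with h | h <;> simp [h]
    · by_contra h0
      exact ha (hl (by simpa using h0))
  refine ⟨_, _, ⟨fun a => ?_, support_restrictWeights_subset _ _⟩,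
    ⟨fun a => ?_, support_restrictWeights_subset _ _⟩, he, fun h => by rw [he, h, sub_self]⟩
  all_goals rw [restrictWeights_apply]; split_ifs <;> simp

namespace IsTri

variable {A : Set E} {T : Finset (Finset E)}

lemma affineIndependent (h : IsTri A T) {s : Finset E} (hs : s ∈ T) :
    AffineIndependent ℝ ((↑) : s → E) := by
  rw [affineIndependent_iff_hom]
  intro l hl h0
  obtain ⟨m, n, hm, hn, rfl, h1⟩ := exists_sub_isWeight hl
  exact h1 (h.unique s hs s hs m n hm hn (by rwa [map_sub, sub_eq_zero] at h0))

lemma subset (h : IsTri A T) {s : Finset E} (hs : s ∈ T) : (s : Set E) ⊆ A := by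
  rw [← h.iUnion_vertices]
  exact Set.subset_biUnion_of_mem (u := fun s : Finset E => (s : Set E)) hs

lemma finite (h : IsTri A T) : A.Finite := by
  rw [← h.iUnion_vertices]
  exact T.finite_toSet.biUnion fun s _ => s.finite_toSet

lemma mem_affineSpan [FiniteDimensional ℝ E] (h : IsTri A T) {s : Finset E} (hs : s ∈ T) {a : E}
    (ha : a ∈ A) : a ∈ affineSpan ℝ (s : Set E) := by
  have := (h.affineIndependent hs).affineSpan_eq_of_le_of_card_eq_finrank_add_one
    (sp := affineSpan ℝ A) (by simpa using affineSpan_mono ℝ (h.subset hs))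
    (by rw [direction_affineSpan]; simpa using h.card_eq s hs)
  rw [Subtype.range_coe_subtype] at this
  have h2 : affineSpan ℝ (s : Set E) = affineSpan ℝ A := by simpa using this
  rw [h2]
  exact subset_affineSpan ℝ A ha

/-- Two distinct cells with a common facet lie on opposite sides of it. -/
lemma opposite (h : IsTri A T) {G : Finset E} {u v : E} (hu : insert u G ∈ T)
    (hv : insert v G ∈ T) (huv : u ≠ v) (huG : u ∉ G) {κ : ℝ} (hκ : 0 ≤ κ)
    {l : E →₀ ℝ} (hl : l.support ⊆ G) (he : ((1 : ℝ), u) = κ • ((1 : ℝ), v) + hom l) : False := by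
  obtain ⟨m, n, hm, hn, rfl, -⟩ := exists_sub_isWeight hl
  -- Moving the negative part of `l` across makes both sides nonnegative weights on cells. Comparing
  -- them at `u` gives `1 = 0`.
  have := h.unique _ hu _ hv (single u 1 + n) (single v κ + m)
    ((isWeight_single (Finset.mem_insert_self _ _) zero_le_one).add
      (hn.mono (Finset.subset_insert _ _)))
    ((isWeight_single (Finset.mem_insert_self _ _) hκ).add (hm.mono (Finset.subset_insert _ _)))
    (by
      simp only [map_add, hom_single, one_smul]
      rw [he, map_sub]
      simp only [Prod.smul_mk, smul_eq_mul, mul_one]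
      abel)
  have := DFunLike.congr_fun this u
  simp [hn.eq_zero huG, hm.eq_zero huG, huv.symm] at this

/-- Modulo the span of `G`, both `u₁` and `u₂` are negative multiples of `v`, hence nonnegative
multiples of each other. They lie on the same side of the facet, against `opposite`. -/
lemma eq_of_facet [FiniteDimensional ℝ E] (h : IsTri A T) {G : Finset E} {v u₁ u₂ : E}
    (hv : insert v G ∈ T) (h₁ : insert u₁ G ∈ T) (h₂ : insert u₂ G ∈ T) (hv1 : u₁ ≠ v)
    (hv2 : u₂ ≠ v) (h1G : u₁ ∉ G) (h2G : u₂ ∉ G) : u₁ = u₂ := by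
  by_contra hne
  have key : ∀ u, insert u G ∈ T → u ≠ v → u ∉ G → ∃ (κ : ℝ) (l : E →₀ ℝ), κ < 0 ∧
      l.support ⊆ G ∧ ((1 : ℝ), u) = κ • ((1 : ℝ), v) + hom l := by
    intro u hu huv huG
    obtain ⟨l, hl, he⟩ := exists_of_mem_affineSpan
      (h.mem_affineSpan hv (h.subset hu (Finset.mem_insert_self u G)))
    have h1 : (l.erase v).support ⊆ G := by
      rw [Finsupp.support_erase]
      intro a ha
      rw [Finset.mem_erase] at ha
      exact (Finset.mem_insert.1 (hl ha.2)).resolve_left ha.1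
    have h2 : ((1 : ℝ), u) = l v • ((1 : ℝ), v) + hom (l.erase v) := by
      conv_lhs => rw [← he, ← Finsupp.single_add_erase v l]
      rw [map_add, hom_single]; simp
    refine ⟨l v, l.erase v, ?_, h1, h2⟩
    by_contra hκ
    exact h.opposite hu hv huv huG (not_lt.1 hκ) h1 h2
  obtain ⟨κ, l, hκ, hl, e1⟩ := key u₁ h₁ hv1 h1G
  obtain ⟨κ', l', hκ', hl', e2⟩ := key u₂ h₂ hv2 h2G
  refine h.opposite h₁ h₂ hne h1G (div_nonneg_of_nonpos hκ.le hκ'.le)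
    (l := l - (κ / κ') • l') ?_ ?_
  · exact Finsupp.support_sub.trans (Finset.union_subset hl
      (Finsupp.support_smul.trans hl'))
  · rw [e1, e2, map_sub, map_smul, smul_add, smul_smul, div_mul_cancel₀ _ hκ'.ne]
    abel

end IsTri

lemma exists_extend_mem_of_mem_intrinsicInterior {C : Set E} {x v : E}
    (hx : x ∈ intrinsicInterior ℝ C) (hv : v ∈ C) : ∃ ε : ℝ, 0 < ε ∧ x + ε • (x - v) ∈ C := by
  obtain ⟨y, hy, rfl⟩ := mem_intrinsicInterior.1 hx
  let f : ℝ → affineSpan ℝ C := fun t =>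
    ⟨AffineMap.lineMap (y : E) v (-t), AffineMap.lineMap_mem _ y.2 (subset_affineSpan ℝ C hv)⟩
  have hf : Continuous f := Continuous.subtype_mk (by
    simp only [AffineMap.lineMap_apply]; fun_prop) _
  have h0 : f 0 = y := Subtype.ext (by simp [f])
  have hn : ∀ᶠ t in nhds (0 : ℝ), f t ∈ interior ((↑) ⁻¹' C : Set (affineSpan ℝ C)) :=
    hf.continuousAt.eventually_mem (isOpen_interior.mem_nhds (by rwa [h0]))
  obtain ⟨ε, hε, h⟩ := Metric.eventually_nhds_iff.1 hn
  refine ⟨ε / 2, by positivity, ?_⟩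
  have h1 := interior_subset (h (y := ε / 2) (by
    rw [Real.dist_eq, sub_zero, abs_of_pos] <;> linarith))
  have h2 : ((f (ε / 2) : affineSpan ℝ C) : E) = y + (ε / 2) • ((y : E) - v) := by
    simp only [f, AffineMap.lineMap_apply, vsub_eq_sub, vadd_eq_add]
    module
  rw [← h2]; exact h1

lemma exists_uniform_weight {G : Finset E} (hG : G.Nonempty) :
    ∃ l g, IsWeight G l ∧ hom l = (1, g) ∧ ∀ a ∈ G, 0 < l a := by
  have hc : (0 : ℝ) < G.card := by exact_mod_cast hG.card_pos
  refine ⟨restrictWeights G fun _ => (G.card : ℝ)⁻¹, ∑ a ∈ G, (G.card : ℝ)⁻¹ • a, ⟨fun a => ?_,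
    support_restrictWeights_subset _ _⟩, ?_, fun a ha => ?_⟩
  · rw [restrictWeights_apply]; split_ifs <;> positivity
  · rw [hom_restrictWeights]
    simp [hc.ne']
  · simp only [restrictWeights_apply, ha, if_true]; positivity

namespace IsTri

variable {A : Set E} {T : Finset (Finset E)}

/-- By uniqueness the weights of a point do not depend on the cell used to express it. -/
lemma mem_of_mem_convexHull (h : IsTri A T) {s t : Finset E} (hs : s ∈ T) (ht : t ∈ T) {x : E}
    {l : E →₀ ℝ} (hl : IsWeight s l) (hx : hom l = (1, x)) (hxt : x ∈ convexHull ℝ (t : Set E)) :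
    l.support ⊆ t := by
  obtain ⟨m, hm, hm1⟩ := mem_convexHull_iff_exists_weight.1 hxt
  rw [h.unique s hs t ht l m hl hm (hx.trans hm1.symm)]
  exact hm.support

/-- A path from a point of the facet directly away from `v` leaves `s` at once but stays in the hull
for a while. A cell meeting it arbitrarily near its start contains the start, being closed, and
hence all facet vertices if these have positive weight there. -/
lemma exists_adjacent (h : IsTri A T) {s : Finset E} {v c : E} (hs : s ∈ T) (hv : v ∈ s)
    (hc : c ∈ convexHull ℝ (s.erase v : Set E)) (hci : c ∈ intrinsicInterior ℝ (convexHull ℝ A)) :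
    ∃ t ∈ T, t ≠ s ∧ s.erase v ⊆ t := by
  have hG : (s.erase v).Nonempty := by
    exact_mod_cast convexHull_nonempty_iff.1 ⟨c, hc⟩
  obtain ⟨lc, hlc, hlc1⟩ := mem_convexHull_iff_exists_weight.1 hc
  obtain ⟨lg, g, hlg, hlg1, hpos⟩ := exists_uniform_weight hG
  obtain ⟨δ, hδ, hz⟩ := exists_extend_mem_of_mem_intrinsicInterior hci
    (subset_convexHull ℝ A (h.subset hs hv))
  -- Averaging `c` with the barycentre `g` makes every facet weight positive and keeps the freedom
  -- to move away from `v`.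
  set γ : E →₀ ℝ := (1 / 2 : ℝ) • lc + (1 / 2 : ℝ) • lg with hγ
  have hγw : IsWeight (s.erase v) γ := (hlc.smul (by norm_num)).add (hlg.smul (by norm_num))
  have hγs : IsWeight s γ := hγw.mono (Finset.erase_subset _ _)
  set c' : E := (1 / 2 : ℝ) • c + (1 / 2 : ℝ) • g with hc'
  have hγ1 : hom γ = (1, c') := by
    rw [hγ, map_add, map_smul, map_smul, hlc1, hlg1]
    ext <;> simp [hc']; norm_num
  have hγpos : ∀ a ∈ s.erase v, 0 < γ a := fun a ha => by
    have := hpos a ha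
    have := hlc.nonneg a
    simp only [hγ, Finsupp.add_apply, Finsupp.smul_apply, smul_eq_mul]
    linarith
  have hgA : g ∈ convexHull ℝ A := convexHull_mono ((Finset.coe_subset.2
    (Finset.erase_subset _ _)).trans (h.subset hs)) (mem_convexHull_iff_exists_weight.2
      ⟨lg, hlg, hlg1⟩)
  have hc'A : c' ∈ convexHull ℝ A := convexHull_mono ((Finset.coe_subset.2
    (Finset.erase_subset _ _)).trans (h.subset hs)) (mem_convexHull_iff_exists_weight.2
      ⟨γ, hγw, hγ1⟩)
  -- With this `ε`, the endpoint `c' + ε (c' - v)` is a convex combination of `c + δ (c - v)` and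
  -- `g`.
  set ε : ℝ := δ / (2 + δ) with hε
  have hε0 : 0 < ε := by positivity
  let f : ℝ → E := fun η => c' + η • (c' - v)
  have hf : Continuous f := by fun_prop
  have hfε : f ε ∈ convexHull ℝ A := by
    have : f ε = (1 / (2 + δ)) • (c + δ • (c - v)) + ((1 + δ) / (2 + δ)) • g := by
      have h2 : (2 + δ) ≠ 0 := by positivity
      have e1 : 1 + ε = 2 * (1 + δ) / (2 + δ) := by rw [hε]; field_simp; ring
      have : f ε = (1 + ε) • c' - ε • v := by simp only [f]; module
      rw [this, e1, hc', hε]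
      match_scalars <;> field_simp
    rw [this]
    refine (convex_convexHull ℝ A) hz hgA (by positivity) (by positivity) ?_
    field_simp; ring
  have hfA : ∀ η ∈ Set.Ioc 0 ε, f η ∈ convexHull ℝ A := by
    intro η hη
    have : f η = (1 - η / ε) • c' + (η / ε) • f ε := by
      simp only [f]
      match_scalars <;> field_simp <;> ring
    rw [this]
    have h1 : η / ε ≤ 1 := (div_le_one hε0).2 hη.2
    exact (convex_convexHull ℝ A) hc'A hfε (by linarith) (div_nonneg hη.1.le hε0.le) (by ring)
  have hcl : ∀ t : Finset E, IsClosed (convexHull ℝ (t : Set E)) := fun t =>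
    t.finite_toSet.isClosed_convexHull ℝ
  have h0 : (0 : ℝ) ∈ closure (⋃ t ∈ T, f ⁻¹' (convexHull ℝ (t : Set E)) ∩ Set.Ioc 0 ε) := by
    have : (0 : ℝ) ∈ closure (Set.Ioc 0 ε) := by
      rw [closure_Ioc hε0.ne]; exact ⟨le_rfl, hε0.le⟩
    refine closure_mono (fun η hη => ?_) this
    obtain ⟨t, ht, h1⟩ := Set.mem_iUnion₂.1 (h.cover (hfA η hη))
    exact Set.mem_iUnion₂.2 ⟨t, ht, h1, hη⟩
  -- There are finitely many cells, so a single one contains path points with parameters tending to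
  -- `0`.
  rw [Finset.closure_biUnion] at h0
  obtain ⟨t, ht, h0⟩ := Set.mem_iUnion₂.1 h0
  obtain ⟨η, hη1, hη⟩ := closure_nonempty_iff.1 ⟨0, h0⟩
  have hc't : c' ∈ convexHull ℝ (t : Set E) := by
    have := closure_minimal Set.inter_subset_left ((hcl t).preimage hf) h0
    simpa [f] using this
  refine ⟨t, ht, ?_, fun a ha => h.mem_of_mem_convexHull hs ht hγs hγ1 hc't
    (Finsupp.mem_support_iff.2 (hγpos a ha).ne')⟩
  -- Were the cell `s` itself, a path point would have weight zero at `v` after adding mass `η > 0`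
  -- there.
  rintro rfl
  obtain ⟨m, hm, hm1⟩ := mem_convexHull_iff_exists_weight.1 hη1
  have := h.unique t ht t ht (m + single v η) ((1 + η) • γ)
    (hm.add (isWeight_single hv hη.1.le)) (hγs.smul (by linarith [hη.1])) (by
      rw [map_add, map_smul, hm1, hγ1, hom_single]
      ext
      · simp
      · simp only [f, Prod.snd_add, Prod.smul_snd]; module)
  have := DFunLike.congr_fun this v
  simp [hγw.eq_zero (Finset.notMem_erase v t)] at this
  linarith [hm.nonneg v, hη.1]

/-- `exists_adjacent` supplies a second cell and `eq_of_facet` excludes a third. -/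
lemma ncard_facet [FiniteDimensional ℝ E] (h : IsTri A T) {s : Finset E} {v c : E} (hs : s ∈ T)
    (hv : v ∈ s) (hc : c ∈ convexHull ℝ (s.erase v : Set E))
    (hci : c ∈ intrinsicInterior ℝ (convexHull ℝ A)) :
    {t : Finset E | t ∈ T ∧ ∃ u ∈ t, (t : Set E) \ {u} = (s : Set E) \ {v}}.ncard = 2 := by
  obtain ⟨t, ht, hts, hst⟩ := h.exists_adjacent hs hv hc hci
  have key : ∀ t ∈ T, s.erase v ⊆ t → ∃ u, u ∉ s.erase v ∧ insert u (s.erase v) = t := by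
    intro t ht hst
    have := Finset.exists_eq_insert_iff.2 ⟨hst, by
      rw [Finset.card_erase_add_one hv, h.card_eq s hs, h.card_eq t ht]⟩
    obtain ⟨u, hu, e⟩ := this
    exact ⟨u, hu, e⟩
  obtain ⟨u, hu, rfl⟩ := key t ht hst
  have : {t : Finset E | t ∈ T ∧ ∃ u ∈ t, (t : Set E) \ {u} = (s : Set E) \ {v}} =
      {s, insert u (s.erase v)} := by
    ext r
    simp only [Set.mem_ofPred_eq, Set.mem_insert_iff, Set.mem_singleton_iff]
    constructor
    · rintro ⟨hr, w, hw, he⟩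
      rw [← Finset.coe_erase, ← Finset.coe_erase, Finset.coe_inj] at he
      obtain ⟨w', hw', rfl⟩ := key r hr (he ▸ Finset.erase_subset _ _)
      by_cases hwv : w' = v
      · left; rw [hwv, Finset.insert_erase hv]
      · right
        rw [h.eq_of_facet (by rwa [Finset.insert_erase hv]) hr ht hwv ?_ hw' hu]
        rintro rfl
        exact hts (Finset.insert_erase hv)
    · rintro (rfl | rfl)
      · exact ⟨hs, v, hv, rfl⟩
      · refine ⟨ht, u, Finset.mem_insert_self _ _, ?_⟩
        rw [← Finset.coe_erase, ← Finset.coe_erase, Finset.erase_insert hu]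
  rw [this, Set.ncard_pair hts.symm]

lemma convexHull_inter_subset (h : IsTri A T) {s : Finset E} (hs : s ∈ T) :
    convexHull ℝ (s : Set E) ∩ A ⊆ s := by
  rintro a ⟨ha, haA⟩
  rw [← h.iUnion_vertices] at haA
  obtain ⟨t, ht, hat⟩ := Set.mem_iUnion₂.1 haA
  have := h.mem_of_mem_convexHull ht hs (isWeight_single (Finset.mem_coe.1 hat) zero_le_one)
    (x := a) (by simp) ha
  exact this (by simp)

/-- A common interior point can be pushed within `s` away from a vertex `v ∉ t`. This writes it, up
to scale, with positive weight at `v`, although its weights in `t` vanish there. -/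
lemma disjoint_intrinsicInterior (h : IsTri A T) {s t : Finset E} (hs : s ∈ T) (ht : t ∈ T)
    (hst : s ≠ t) : Disjoint (intrinsicInterior ℝ (convexHull ℝ (s : Set E)))
      (intrinsicInterior ℝ (convexHull ℝ (t : Set E))) := by
  rw [Set.disjoint_left]
  intro x hxs hxt
  have hsub : ¬ s ⊆ t := fun hsub => hst (Finset.eq_of_subset_of_card_le hsub
    (by rw [h.card_eq s hs, h.card_eq t ht]))
  obtain ⟨v, hv, hvt⟩ := Finset.not_subset.1 hsub
  obtain ⟨ε, hε, hy⟩ := exists_extend_mem_of_mem_intrinsicInterior hxs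
    (subset_convexHull ℝ _ (Finset.mem_coe.2 hv))
  obtain ⟨m, hm, hm1⟩ := mem_convexHull_iff_exists_weight.1 hy
  obtain ⟨l, hl, hl1⟩ := mem_convexHull_iff_exists_weight.1 (intrinsicInterior_subset hxt)
  have := h.unique s hs t ht (m + single v ε) ((1 + ε) • l)
    (hm.add (isWeight_single hv hε.le)) (hl.smul (by linarith)) (by
      rw [map_add, map_smul, hm1, hl1, hom_single]
      ext
      · simp
      · simp only [Prod.snd_add, Prod.smul_snd]; module)
  have := DFunLike.congr_fun this v
  simp [hl.eq_zero hvt] at this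
  linarith [hm.nonneg v]

end IsTri

lemma IsTri.isTriangulation {d : ℕ} {A : Set (EuclideanSpace ℝ (Fin d))}
    {T : Finset (Finset (EuclideanSpace ℝ (Fin d)))} (h : IsTri A T) : IsTriangulation A T where
  affineIndependent s hs := h.affineIndependent hs
  card_eq := h.card_eq
  vertices_subset s hs := h.subset hs
  disjoint_interiors s hs t ht := h.disjoint_intrinsicInterior hs ht
  facets s hs v hv := by
    by_cases hsub : convexHull ℝ ((s : Set (EuclideanSpace ℝ (Fin d))) \ {v}) ⊆
        intrinsicFrontier ℝ (convexHull ℝ A)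
    · exact Or.inl hsub
    · right
      obtain ⟨c, hc, hcn⟩ := Set.not_subset.1 hsub
      rw [← Finset.coe_erase] at hc
      refine h.ncard_facet hs hv hc ?_
      rw [← intrinsicClosure_sdiff_intrinsicFrontier]
      exact ⟨subset_intrinsicClosure (convexHull_mono ((Finset.coe_subset.2
        (Finset.erase_subset _ _)).trans (h.subset hs)) hc), hcn⟩
  no_other_points s hs := h.convexHull_inter_subset hs
  iUnion_vertices := h.iUnion_vertices
  iUnion_simplices := h.cover.antisymm'
    (Set.iUnion₂_subset fun s hs => convexHull_mono (h.subset hs))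

end Tri

/-! ### Stellar subdivision and its cell count. -/

section Stellar

open Finsupp
open scoped Classical

variable {E : Type*} [NormedAddCommGroup E] [NormedSpace ℝ E] [DecidableEq E]

lemma two_le_card_support {A : Set E} {F : Finset E} {ω : E →₀ ℝ} {w : E} (hF : ω.support = F)
    (hFA : (F : Set E) ⊆ A) (hω : hom ω = (1, w)) (hw : w ∉ A) : 2 ≤ F.card := by
  by_contra hlt
  obtain ⟨a, ha⟩ := Finset.card_le_one_iff_subset_singleton.1 (Nat.le_of_lt_succ (not_le.1 hlt))
  obtain ⟨b, rfl⟩ := Finsupp.support_subset_singleton'.1 (hF.trans_subset ha)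
  rw [hom_single, Prod.mk.injEq] at hω
  obtain ⟨rfl, h2⟩ := hω
  refine hw (h2 ▸ hFA ?_)
  rw [← hF]; simp

/-- Stellar subdivision at `w`, where `F` is the face carrying `w` in its relative interior. -/
noncomputable def stellar (T : Finset (Finset E)) (w : E) (F : Finset E) : Finset (Finset E) :=
  (T.filter fun s => ¬ F ⊆ s) ∪
    ((T.filter fun s => F ⊆ s) ×ˢ F).image fun p => insert w (p.1.erase p.2)

lemma mem_stellar {T : Finset (Finset E)} {w : E} {F t : Finset E} :
    t ∈ stellar T w F ↔ (t ∈ T ∧ ¬ F ⊆ t) ∨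
      ∃ s ∈ T, F ⊆ s ∧ ∃ v ∈ F, insert w (s.erase v) = t := by
  simp only [stellar, Finset.mem_union, Finset.mem_filter, Finset.mem_image, Finset.mem_product,
    Prod.exists]
  constructor
  · rintro (h | ⟨s, v, ⟨⟨h1, h2⟩, h3⟩, h4⟩)
    exacts [Or.inl h, Or.inr ⟨s, h1, h2, v, h3, h4⟩]
  · rintro (h | ⟨s, h1, h2, v, h3, h4⟩)
    exacts [Or.inl h, Or.inr ⟨s, v, ⟨⟨h1, h2⟩, h3⟩, h4⟩]

/-- Each cell containing `F` is replaced by `|F|` cells, one for each vertex of `F` dropped. The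
additive form avoids truncated subtraction. -/
lemma card_stellar {T : Finset (Finset E)} {w : E} {F : Finset E} (hw : ∀ s ∈ T, w ∉ s) :
    (stellar T w F).card + (T.filter fun s => F ⊆ s).card =
      T.card + (T.filter fun s => F ⊆ s).card * F.card := by
  rw [stellar, Finset.card_union_of_disjoint, Finset.card_image_of_injOn, Finset.card_product,
    ← Finset.card_filter_add_card_filter_not (s := T) (fun s => F ⊆ s)]
  · ring
  · rintro ⟨s, v⟩ hs ⟨s', v'⟩ hs' he
    simp only [Finset.coe_product, Set.mem_prod, Finset.mem_coe, Finset.mem_filter] at hs hs' he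
    obtain ⟨⟨hs, hFs⟩, hv⟩ := hs
    obtain ⟨⟨hs', hFs'⟩, hv'⟩ := hs'
    have he' : s.erase v = s'.erase v' := by
      rw [← Finset.erase_insert (s := s.erase v) (a := w)
        (fun h => hw s hs (Finset.mem_of_mem_erase h)), he,
        Finset.erase_insert (fun h => hw s' hs' (Finset.mem_of_mem_erase h))]
    have hvv : v = v' := by
      by_contra hne
      have : v ∈ s'.erase v' := Finset.mem_erase.2 ⟨hne, hFs' hv⟩
      rw [← he'] at this
      exact Finset.notMem_erase _ _ this
    subst hvv
    rw [Prod.mk.injEq]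
    exact ⟨by rw [← Finset.insert_erase (hFs hv), he', Finset.insert_erase (hFs' hv)], rfl⟩
  · rw [Finset.disjoint_left]
    intro t ht ht'
    obtain ⟨⟨s, v⟩, -, rfl⟩ := Finset.mem_image.1 ht'
    exact hw _ (Finset.mem_filter.1 ht).1 (Finset.mem_insert_self _ _)

namespace IsTri

variable {A : Set E} {T : Finset (Finset E)}

/-- A face meeting the relative interior lies in many cells. -/
lemma le_card_star (h : IsTri A T) {s F : Finset E} {w : E} (hs : s ∈ T)
    (hFs : F ⊆ s) (hw : w ∈ convexHull ℝ (F : Set E))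
    (hwi : w ∈ intrinsicInterior ℝ (convexHull ℝ A)) :
    Module.finrank ℝ (vectorSpan ℝ A) + 2 ≤ (T.filter fun s => F ⊆ s).card + F.card := by
  have key : ∀ v ∈ s \ F, ∃ t ∈ T, t ≠ s ∧ s.erase v ⊆ t := by
    intro v hv
    rw [Finset.mem_sdiff] at hv
    refine h.exists_adjacent hs hv.1 (convexHull_mono ?_ hw) hwi
    exact_mod_cast Finset.subset_erase.2 ⟨hFs, hv.2⟩
  choose! t htT hts hst using key
  have h1 : (s \ F).card ≤ ((T.filter fun s => F ⊆ s).erase s).card := by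
    refine Finset.card_le_card_of_injOn t ?_ ?_
    · intro v hv
      have hv' := Finset.mem_sdiff.1 hv
      rw [Finset.mem_coe, Finset.mem_erase, Finset.mem_filter]
      exact ⟨hts v hv, htT v hv, (Finset.subset_erase.2 ⟨hFs, hv'.2⟩).trans (hst v hv)⟩
    -- A common neighbour across the facets opposite `v ≠ v'` would contain all of `s`, hence equal
    -- it.
    · intro v hv v' hv' he
      by_contra hne
      refine hts v hv (Finset.eq_of_subset_of_card_le (fun a ha => ?_) ?_).symm
      · by_cases hav : a = v
        · rw [he]
          refine hst v' hv' (Finset.mem_erase.2 ⟨?_, ha⟩)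
          rwa [hav]
        · exact hst v hv (Finset.mem_erase.2 ⟨hav, ha⟩)
      · rw [h.card_eq _ hs, h.card_eq _ (htT v hv)]
  have hmem : s ∈ T.filter fun s => F ⊆ s := Finset.mem_filter.2 ⟨hs, hFs⟩
  rw [Finset.card_erase_of_mem hmem, Finset.card_sdiff_of_subset hFs,
    h.card_eq s hs] at h1
  have h2 : 0 < (T.filter fun s => F ⊆ s).card :=
    Finset.card_pos.2 ⟨s, hmem⟩
  omega

lemma exists_carrier (h : IsTri A T) {w : E} (hw : w ∈ convexHull ℝ A) :
    ∃ s ∈ T, ∃ ω, IsWeight s ω ∧ hom ω = (1, w) := by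
  obtain ⟨s, hs, hws⟩ := Set.mem_iUnion₂.1 (h.cover hw)
  obtain ⟨ω, h1, h2⟩ := mem_convexHull_iff_exists_weight.1 hws
  exact ⟨s, hs, ω, h1, h2⟩

/-- Spreading the mass at `w` over its carrier by `ω` turns weights on new cells into weights on old
ones. Since a new cell omits a vertex of `F`, the mass at `w` can be recovered, so uniqueness is
inherited. For the covering, as much of `ω` as possible is collected into `w`. -/
lemma isTri_stellar (h : IsTri A T) {s₀ : Finset E} {w : E} {ω : E →₀ ℝ} (hs₀ : s₀ ∈ T)
    (hω : IsWeight s₀ ω) (hω1 : hom ω = (1, w)) (hwA : w ∉ A) :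
    IsTri (insert w A) (stellar T w ω.support) := by
  have hwT : ∀ s ∈ T, w ∉ s := fun s hs hw => hwA (h.subset hs hw)
  set F := ω.support with hF
  have hF2 : 2 ≤ F.card := two_le_card_support rfl
    ((Finset.coe_subset.2 hω.support).trans (h.subset hs₀)) hω1 hwA
  have hωpos : ∀ v ∈ F, 0 < ω v := fun v hv =>
    lt_of_le_of_ne (hω.nonneg v) (Ne.symm (Finsupp.mem_support_iff.1 hv))
  have hωw : ω w = 0 := hω.eq_zero (hwT s₀ hs₀)
  have hwA' : w ∈ convexHull ℝ A :=
    convexHull_mono (h.subset hs₀) (mem_convexHull_iff_exists_weight.2 ⟨ω, hω, hω1⟩)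
  have hspan : vectorSpan ℝ (insert w A) = vectorSpan ℝ A := by
    rw [← direction_affineSpan, affineSpan_insert_eq_affineSpan _
      (convexHull_subset_affineSpan A hwA'), direction_affineSpan]
  have push : ∀ t ∈ stellar T w F, ∀ l, IsWeight t l →
      (∃ s ∈ T, IsWeight s (l.erase w + l w • ω)) ∧ ∃ v ∈ F, l v = 0 := by
    intro t ht l hl
    rcases mem_stellar.1 ht with ⟨ht, hFt⟩ | ⟨s, hs, hFs, v, hv, rfl⟩
    · have hlw : l w = 0 := hl.eq_zero (hwT t ht)
      obtain ⟨v, hv, hvt⟩ := Finset.not_subset.1 hFt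
      refine ⟨⟨t, ht, ?_⟩, v, hv, hl.eq_zero hvt⟩
      rwa [hlw, zero_smul, add_zero, Finsupp.erase_of_notMem_support (by simp [hlw])]
    · have hvw : v ≠ w := by rintro rfl; exact hwT s hs (hFs hv)
      refine ⟨⟨s, hs, IsWeight.add ⟨fun a => ?_, ?_⟩
        (IsWeight.smul ⟨hω.nonneg, hFs⟩ (hl.nonneg w))⟩, v, hv, hl.eq_zero ?_⟩
      · rw [Finsupp.erase_apply]; split_ifs
        exacts [le_rfl, hl.nonneg a]
      · rw [Finsupp.support_erase]
        intro a ha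
        obtain ⟨h1, h2⟩ := Finset.mem_erase.1 ha
        exact Finset.mem_of_mem_erase ((Finset.mem_insert.1 (hl.support h2)).resolve_left h1)
      · simp [hvw]
  have hhom : ∀ l : E →₀ ℝ, hom (l.erase w + l w • ω) = hom l := by
    intro l
    conv_rhs => rw [← Finsupp.single_add_erase w l]
    rw [map_add, map_add, map_smul, hω1, hom_single, add_comm]
    simp
  -- At a vertex `v` where `l` vanishes, the spread weights are `l w * ω v` and at least `m w * ω
  -- v`.
  have hle : ∀ l m : E →₀ ℝ, (∃ v ∈ F, l v = 0) → (∀ v, 0 ≤ m v) →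
      l.erase w + l w • ω = m.erase w + m w • ω → m w ≤ l w := by
    rintro l m ⟨v, hv, hlv⟩ hm he
    have hvw : v ≠ w := by rintro rfl; exact (hωpos v hv).ne' hωw
    have := DFunLike.congr_fun he v
    simp only [Finsupp.add_apply, Finsupp.erase_ne hvw, hlv, Finsupp.smul_apply, smul_eq_mul,
      zero_add] at this
    refine le_of_mul_le_mul_right ?_ (hωpos v hv)
    linarith [hm v]
  refine ⟨?_, ?_, ?_, ?_⟩
  · intro s hs t ht l m hl hm hlm
    obtain ⟨⟨s', hs', hl'⟩, hlv⟩ := push s hs l hl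
    obtain ⟨⟨t', ht', hm'⟩, hmv⟩ := push t ht m hm
    have he := h.unique s' hs' t' ht' _ _ hl' hm' (by rw [hhom, hhom, hlm])
    have hw : l w = m w :=
      (hle m l hmv hl.nonneg he.symm).antisymm (hle l m hlv hm.nonneg he)
    rw [hw, add_left_inj] at he
    rw [← Finsupp.single_add_erase w l, ← Finsupp.single_add_erase w m, he, hw]
  · intro t ht
    rw [hspan]
    rcases mem_stellar.1 ht with ⟨ht, -⟩ | ⟨s, hs, hFs, v, hv, rfl⟩
    · exact h.card_eq t ht
    · rw [Finset.card_insert_of_notMem fun hw => hwT s hs (Finset.mem_of_mem_erase hw),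
        Finset.card_erase_add_one (hFs hv), h.card_eq s hs]
  · apply Set.Subset.antisymm
    · refine Set.iUnion₂_subset fun t ht => ?_
      rcases mem_stellar.1 ht with ⟨ht, -⟩ | ⟨s, hs, hFs, v, hv, rfl⟩
      · exact (h.subset ht).trans (Set.subset_insert _ _)
      · rw [Finset.coe_insert]
        exact Set.insert_subset_insert
          ((Finset.coe_subset.2 (Finset.erase_subset _ _)).trans (h.subset hs))
    · rintro a (rfl | ha)
      · obtain ⟨v, hv⟩ : F.Nonempty := Finset.card_pos.1 (by omega)
        exact Set.mem_iUnion₂.2 ⟨insert a (s₀.erase v),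
          mem_stellar.2 (Or.inr ⟨s₀, hs₀, hω.support, v, hv, rfl⟩), by simp⟩
      · rw [← h.iUnion_vertices] at ha
        obtain ⟨s, hs, has⟩ := Set.mem_iUnion₂.1 ha
        by_cases hFs : F ⊆ s
        · obtain ⟨v, hv, hva⟩ := Finset.exists_mem_ne (by omega : 1 < F.card) a
          refine Set.mem_iUnion₂.2 ⟨insert w (s.erase v),
            mem_stellar.2 (Or.inr ⟨s, hs, hFs, v, hv, rfl⟩), ?_⟩
          exact Finset.mem_insert_of_mem (Finset.mem_erase.2 ⟨hva.symm, has⟩)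
        · exact Set.mem_iUnion₂.2 ⟨s, mem_stellar.2 (Or.inl ⟨hs, hFs⟩), has⟩
  · intro x hx
    have hx' : x ∈ convexHull ℝ A := convexHull_min
      (Set.insert_subset hwA' (subset_convexHull ℝ A)) (convex_convexHull ℝ A) hx
    obtain ⟨s, hs, l, hl, hlx⟩ := h.exists_carrier hx'
    by_cases hFs : F ⊆ s
    -- The minimal ratio is the largest multiple of `ω` that fits under `l`; the vertex attaining it
    -- is dropped.
    · obtain ⟨v, hv, hmin⟩ := Finset.exists_min_image F (fun v => l v / ω v)
        (Finset.card_pos.1 (by omega))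
      set α := l v / ω v with hα
      have hα0 : 0 ≤ α := div_nonneg (hl.nonneg v) (hωpos v hv).le
      refine Set.mem_iUnion₂.2 ⟨insert w (s.erase v),
        mem_stellar.2 (Or.inr ⟨s, hs, hFs, v, hv, rfl⟩), ?_⟩
      refine mem_convexHull_iff_exists_weight.2 ⟨(l - α • ω) + single w α, IsWeight.add
        ⟨fun a => ?_, ?_⟩ (isWeight_single (Finset.mem_insert_self _ _) hα0), ?_⟩
      · rw [Finsupp.sub_apply, Finsupp.smul_apply, smul_eq_mul]
        by_cases ha : a ∈ F
        · have := (le_div_iff₀ (hωpos a ha)).1 (hmin a ha)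
          linarith
        · have : ω a = 0 := by simpa [hF] using ha
          simpa [this] using hl.nonneg a
      · refine support_subset_of_forall fun a ha => ?_
        simp only [Finset.mem_insert, Finset.mem_erase, not_or, not_and] at ha
        rw [Finsupp.sub_apply, Finsupp.smul_apply, smul_eq_mul]
        by_cases hav : a = v
        · rw [hav, hα, div_mul_cancel₀ _ (hωpos v hv).ne', sub_self]
        · have has := ha.2 hav
          have : ω a = 0 := by simpa [hF] using fun h' => has (hFs h')
          rw [hl.eq_zero has, this]; simp
      · rw [map_add, map_sub, map_smul, hω1, hlx, hom_single]
        simp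
    · exact Set.mem_iUnion₂.2 ⟨s, mem_stellar.2 (Or.inl ⟨hs, hFs⟩),
        mem_convexHull_iff_exists_weight.2 ⟨l, hl, hlx⟩⟩

lemma exists_insert (h : IsTri A T) {w : E} (hw : w ∈ convexHull ℝ A) (hwA : w ∉ A) :
    ∃ T', IsTri (insert w A) T' ∧
      (∀ t' ∈ T', ∃ t ∈ T, convexHull ℝ (t' : Set E) ⊆ convexHull ℝ (t : Set E)) ∧
      T.card ≤ T'.card ∧ (w ∈ intrinsicInterior ℝ (convexHull ℝ A) →
        T.card + Module.finrank ℝ (vectorSpan ℝ A) ≤ T'.card) := by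
  obtain ⟨s₀, hs₀, ω, hω, hω1⟩ := h.exists_carrier hw
  have hF2 : 2 ≤ ω.support.card := two_le_card_support rfl
    ((Finset.coe_subset.2 hω.support).trans (h.subset hs₀)) hω1 hwA
  have hc := card_stellar (F := ω.support) fun s hs (hw : w ∈ s) => hwA (h.subset hs hw)
  refine ⟨_, h.isTri_stellar hs₀ hω hω1 hwA, ?_, ?_, fun hwi => ?_⟩
  · intro t ht
    rcases mem_stellar.1 ht with ⟨ht, -⟩ | ⟨s, hs, hFs, v, hv, rfl⟩
    · exact ⟨t, ht, le_rfl⟩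
    · refine ⟨s, hs, convexHull_min ?_ (convex_convexHull ℝ _)⟩
      rw [Finset.coe_insert]
      refine Set.insert_subset (mem_convexHull_iff_exists_weight.2 ⟨ω, ⟨hω.nonneg, hFs⟩, hω1⟩) ?_
      exact (Finset.coe_subset.2 (Finset.erase_subset _ _)).trans (subset_convexHull ℝ _)
  · nlinarith
  · have := h.le_card_star hs₀ hω.support (mem_convexHull_iff_exists_weight.2
      ⟨ω, ⟨hω.nonneg, Finset.Subset.refl _⟩, hω1⟩) hwi
    have hm : 0 < (T.filter fun s => ω.support ⊆ s).card :=
      Finset.card_pos.2 ⟨s₀, Finset.mem_filter.2 ⟨hs₀, hω.support⟩⟩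
    -- With `m` cells around `F`, `(m - 1)(|F| - 2) ≥ 0` gives `m (|F| - 1) ≥ m + |F| - 2`, which is
    -- at least the dimension.
    nlinarith [Nat.mul_le_mul hm hF2]

end IsTri

end Stellar

/-! ### Avoiding finitely many affine subspaces. -/

section Generic

variable {V : Type*} [AddCommGroup V] [Module ℝ V]

lemma subsingleton_lineMap_mem {Q : AffineSubspace ℝ V} {x y : V} (hy : y ∉ Q) :
    {t : ℝ | AffineMap.lineMap x y t ∈ Q}.Subsingleton := by
  intro t₁ h₁ t₂ h₂
  by_contra hne
  have hne' : t₂ - t₁ ≠ 0 := sub_ne_zero.2 (Ne.symm hne)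
  refine hy ?_
  have : AffineMap.lineMap (AffineMap.lineMap x y t₁ : V) (AffineMap.lineMap x y t₂ : V)
      ((1 - t₁) / (t₂ - t₁)) = y := by
    simp only [AffineMap.lineMap_apply, vsub_eq_sub, vadd_eq_add]
    match_scalars <;> field_simp <;> ring
  rw [← this]
  exact AffineMap.lineMap_mem _ h₁ h₂

lemma finite_lineMap_mem {ι : Type*} (s : Finset ι) (Q : ι → AffineSubspace ℝ V) {x y : V}
    (hy : ∀ i ∈ s, y ∉ Q i) : {t : ℝ | ∃ i ∈ s, AffineMap.lineMap x y t ∈ Q i}.Finite := by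
  have : {t : ℝ | ∃ i ∈ s, AffineMap.lineMap x y t ∈ Q i} =
      ⋃ i ∈ s, {t : ℝ | AffineMap.lineMap x y t ∈ Q i} := by
    ext; simp
  rw [this]
  exact s.finite_toSet.biUnion fun i hi => (subsingleton_lineMap_mem (hy i hi)).finite

/-- A convex set is not covered by finitely many affine subspaces unless one contains it. -/
lemma exists_mem_forall_notMem {ι : Type*} {C : Set V} (hC : Convex ℝ C) (hne : C.Nonempty)
    (s : Finset ι) (Q : ι → AffineSubspace ℝ V) (h : ∀ i ∈ s, ∃ y ∈ C, y ∉ Q i) :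
    ∃ y ∈ C, ∀ i ∈ s, y ∉ Q i := by
  classical
  induction s using Finset.induction_on with
  | empty => obtain ⟨y, hy⟩ := hne; exact ⟨y, hy, by simp⟩
  | insert j s hj ih =>
    obtain ⟨y, hyC, hy⟩ := ih fun i hi => h i (Finset.mem_insert_of_mem hi)
    obtain ⟨z, hzC, hz⟩ := h j (Finset.mem_insert_self _ _)
    -- A line through a point off a subspace meets it at most once, so finitely many parameters are
    -- bad. For the old subspaces the avoiding point is `y`, whence the reversal `1 - t`.
    obtain ⟨t, ht, htn⟩ := (Set.Ioo_infinite (zero_lt_one' ℝ)).exists_notMem_finite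
      ((((finite_lineMap_mem (x := z) s Q hy).preimage
        (sub_right_injective (b := (1 : ℝ))).injOn)).union
        (subsingleton_lineMap_mem (x := y) hz).finite)
    refine ⟨AffineMap.lineMap y z t, hC.lineMap_mem hyC hzC ⟨ht.1.le, ht.2.le⟩, ?_⟩
    rw [Set.mem_union, not_or] at htn
    intro i hi hiQ
    rcases Finset.mem_insert.1 hi with rfl | hi
    · exact htn.2 hiQ
    · refine htn.1 ⟨i, hi, ?_⟩
      rwa [AffineMap.lineMap_apply_one_sub]

lemma subset_closure_forall_notMem {E ι : Type*} [NormedAddCommGroup E] [NormedSpace ℝ E]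
    {C : Set E} (hC : Convex ℝ C) (s : Finset ι) (Q : ι → AffineSubspace ℝ E)
    (h : ∀ i ∈ s, ∃ y ∈ C, y ∉ Q i) : C ⊆ closure {y | y ∈ C ∧ ∀ i ∈ s, y ∉ Q i} := by
  intro x hx
  obtain ⟨y, hyC, hy⟩ := exists_mem_forall_notMem hC ⟨x, hx⟩ s Q h
  have hf : Continuous fun t : ℝ => (AffineMap.lineMap x y t : E) := by
    simp only [AffineMap.lineMap_apply]; fun_prop
  rw [mem_closure_iff_nhds]
  intro U hU
  have : ∀ᶠ t in nhds (0 : ℝ), (AffineMap.lineMap x y t : E) ∈ U :=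
    hf.continuousAt.eventually_mem (by simpa using hU)
  obtain ⟨δ, hδ, hb⟩ := Metric.eventually_nhds_iff.1 this
  obtain ⟨t, ht, htn⟩ := (Set.Ioo_infinite (lt_min hδ one_pos)).exists_notMem_finite
    (finite_lineMap_mem (x := x) s Q hy)
  refine ⟨AffineMap.lineMap x y t, hb ?_, hC.lineMap_mem hx hyC
    ⟨ht.1.le, (ht.2.trans_le (min_le_right _ _)).le⟩, fun i hi hq => htn ⟨i, hi, hq⟩⟩
  rw [Real.dist_eq, sub_zero, abs_of_pos ht.1]
  exact ht.2.trans_le (min_le_left _ _)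

end Generic

/-! ### Regular triangulations from generic heights. -/

section Regular

open Finsupp
open scoped Classical

variable {E : Type*} [NormedAddCommGroup E] [NormedSpace ℝ E] [DecidableEq E]

/-- The weighted sum of heights, as a functional of the height function. -/
noncomputable def heightSum (l : E →₀ ℝ) : (E → ℝ) →ₗ[ℝ] ℝ :=
  ∑ a ∈ l.support, l a • LinearMap.proj a

lemma heightSum_apply (l : E →₀ ℝ) (h : E → ℝ) :
    heightSum l h = Finsupp.linearCombination ℝ h l := by
  simp [heightSum, Finsupp.linearCombination_apply, Finsupp.sum]

lemma heightSum_single (l : E →₀ ℝ) (w : E) (r : ℝ) : heightSum l (Pi.single w r) = l w * r := by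
  rw [heightSum_apply, Finsupp.linearCombination_apply, Finsupp.sum]
  by_cases hw : w ∈ l.support
  · rw [Finset.sum_eq_single_of_mem w hw]
    · simp
    · intro b _ hb; simp [hb]
  · have : l w = 0 := by simpa using hw
    rw [this, zero_mul]
    exact Finset.sum_eq_zero fun b hb => by
      have : b ≠ w := by rintro rfl; exact hw hb
      simp [this]

/-- Interpolating from a cell of the lower hull minimises the weighted sum of heights. -/
lemma heightSum_le_of_lower {A s : Finset E} (hs : AffineIndependent ℝ ((↑) : s → E))
    {c : E → E →₀ ℝ} (hc : ∀ a, (c a).support ⊆ s) (hc1 : ∀ a, hom (c a) = (1, a)) {h : E → ℝ}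
    (hlow : ∀ a ∈ A, a ∉ s → heightSum (c a) h < h a) {l m : E →₀ ℝ} (hl : IsWeight A l)
    (hm : m.support ⊆ s) (hlm : hom l = hom m) :
    heightSum m h ≤ heightSum l h ∧ (heightSum l h ≤ heightSum m h → l.support ⊆ s) := by
  have hmem : Finsupp.linearCombination ℝ c l ∈ Finsupp.supported ℝ ℝ (s : Set E) := by
    rw [Finsupp.linearCombination_apply]
    exact Submodule.sum_mem _ fun a _ => Submodule.smul_mem _ _
      ((Finsupp.mem_supported _ _).2 (Finset.coe_subset.2 (hc a)))
  -- Replacing each point by its interpolation from `s` preserves mass and sum, and weights on `s`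
  -- are determined by these.
  have hq : Finsupp.linearCombination ℝ c l = m := by
    refine hom_eq_iff_of_affineIndependent hs
      (Finset.coe_subset.1 ((Finsupp.mem_supported _ _).1 hmem)) hm ?_
    rw [← hlm, Finsupp.linearCombination_apply, Finsupp.sum, map_sum]
    simp only [map_smul, hc1]
    rfl
  have hcs : ∀ a ∈ s, heightSum (c a) h = h a := by
    intro a ha
    have : c a = single a 1 := hom_eq_iff_of_affineIndependent hs (hc a)
      (isWeight_single ha zero_le_one).support (by simp [hc1])
    rw [this, heightSum_apply]; simp
  have hmh : heightSum m h = ∑ a ∈ l.support, l a * heightSum (c a) h := by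
    rw [← hq]
    simp only [heightSum_apply]
    rw [Finsupp.linearCombination_apply ℝ l, Finsupp.sum, map_sum]
    simp
  have hlh : heightSum l h = ∑ a ∈ l.support, l a * h a := by
    rw [heightSum_apply, Finsupp.linearCombination_apply, Finsupp.sum]; simp
  have hle : ∀ a ∈ l.support, l a * heightSum (c a) h ≤ l a * h a := fun a ha =>
    mul_le_mul_of_nonneg_left (by
      by_cases has : a ∈ s
      exacts [(hcs a has).le, (hlow a (hl.support ha) has).le]) (hl.nonneg a)
  rw [hmh, hlh]
  refine ⟨Finset.sum_le_sum hle, fun hge a ha => ?_⟩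
  have := (Finset.sum_eq_sum_iff_of_le hle).1 ((Finset.sum_le_sum hle).antisymm hge) a ha
  by_contra has
  exact (hlow a (hl.support ha) has).ne
    (mul_left_cancel₀ (Finsupp.mem_support_iff.1 ha) this)

variable [FiniteDimensional ℝ E]

lemma affineSpan_eq_top_of_card {s : Finset E} (hs : AffineIndependent ℝ ((↑) : s → E))
    (hc : s.card = Module.finrank ℝ E + 1) : affineSpan ℝ (s : Set E) = ⊤ := by
  have := hs.affineSpan_eq_top_iff_card_eq_finrank_add_one.2 (by simpa using hc)
  simpa [Subtype.range_coe_subtype] using this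

lemma card_le_of_affineSpan_eq_top {s : Finset E} (hs : affineSpan ℝ (s : Set E) = ⊤) :
    Module.finrank ℝ E + 1 ≤ s.card := by
  have hne : s.Nonempty := by
    rw [Finset.nonempty_iff_ne_empty]
    rintro rfl
    simp at hs
  have h1 := finrank_vectorSpan_image_finset_le ℝ (id : E → E) s
    (n := s.card - 1) (by have := hne.card_pos; omega)
  have h2 : vectorSpan ℝ (s : Set E) = ⊤ := by
    rw [← direction_affineSpan, hs, AffineSubspace.direction_top]
  have := hne.card_pos
  rw [Finset.image_id, h2, finrank_top] at h1
  omega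

/-- Pivoting: exchanging a vertex of a simplex for a point below its interpolation. -/
lemma exists_pivot {A s : Finset E} (hsA : s ⊆ A) (hs : AffineIndependent ℝ ((↑) : s → E))
    (hcard : s.card = Module.finrank ℝ E + 1) {x a : E} {l m : E →₀ ℝ} (hl : IsWeight s l)
    (hlx : hom l = (1, x)) (hpos : ∀ v ∈ s, 0 < l v) (ha : a ∈ A) (has : a ∉ s)
    (hm : m.support ⊆ s) (hma : hom m = (1, a)) {h : E → ℝ} (hlt : h a < heightSum m h) :
    ∃ s' ⊆ A, AffineIndependent ℝ ((↑) : s' → E) ∧ s'.card = Module.finrank ℝ E + 1 ∧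
      ∃ l', IsWeight s' l' ∧ hom l' = (1, x) ∧ heightSum l' h < heightSum l h := by
  have hms : ∀ b, b ∉ s → m b = 0 := fun b hb => by
    by_contra h0
    exact hb (hm (by simpa using h0))
  have hex : (s.filter fun v => 0 < m v).Nonempty := by
    by_contra hno
    rw [Finset.not_nonempty_iff_eq_empty, Finset.filter_eq_empty_iff] at hno
    have h1 : ∑ v ∈ s, m v = 1 := by
      rw [hom_eq_sum hm, Prod.mk.injEq] at hma; exact hma.1
    have : ∑ v ∈ s, m v ≤ 0 := Finset.sum_nonpos fun v hv => not_lt.1 (hno hv)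
    linarith
  -- The ratio test of the simplex method: `ε` is the most of `m` that can be traded for `a`, and
  -- `v` is the vertex whose weight reaches zero.
  obtain ⟨v, hv, hmin⟩ := Finset.exists_min_image _ (fun v => l v / m v) hex
  obtain ⟨hvs, hmv⟩ := Finset.mem_filter.1 hv
  set ε := l v / m v with hε
  have hε0 : 0 < ε := div_pos (hpos v hvs) hmv
  have hav : a ∉ s.erase v := fun h => has (Finset.mem_of_mem_erase h)
  refine ⟨insert a (s.erase v), Finset.insert_subset ha ((Finset.erase_subset _ _).trans hsA),
    ?_, ?_, (l - ε • m) + single a ε, IsWeight.add ⟨fun b => ?_, ?_⟩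
      (isWeight_single (Finset.mem_insert_self _ _) hε0.le), ?_, ?_⟩
  · rw [affineIndependent_iff_hom]
    intro n hn hn0
    have hsupp : (n.erase a).support ⊆ s := by
      rw [Finsupp.support_erase]
      intro b hb
      obtain ⟨h1, h2⟩ := Finset.mem_erase.1 hb
      exact Finset.mem_of_mem_erase ((Finset.mem_insert.1 (hn h2)).resolve_left h1)
    have h0 : n a • m + n.erase a = 0 := by
      refine affineIndependent_iff_hom.1 hs _ (Finsupp.support_add.trans
        (Finset.union_subset (Finsupp.support_smul.trans hm) hsupp)) ?_
      rw [map_add, map_smul, hma, ← hn0]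
      conv_rhs => rw [← Finsupp.single_add_erase a n]
      rw [map_add, hom_single]; simp
    have hva : v ≠ a := by rintro rfl; exact has hvs
    have hnv : n v = 0 := by
      by_contra hne
      have := hn (Finsupp.mem_support_iff.2 hne)
      simp [hva] at this
    have := DFunLike.congr_fun h0 v
    simp [Finsupp.erase_ne hva, hnv, hmv.ne'] at this
    rw [this, zero_smul, zero_add] at h0
    rw [← Finsupp.single_add_erase a n, this, h0]; simp
  · rw [Finset.card_insert_of_notMem hav, Finset.card_erase_add_one hvs, hcard]
  · rw [Finsupp.sub_apply, Finsupp.smul_apply, smul_eq_mul]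
    by_cases hb : b ∈ s ∧ 0 < m b
    · have := (le_div_iff₀ hb.2).1 (hmin b (Finset.mem_filter.2 hb))
      linarith
    · have hmb : m b ≤ 0 := by
        by_cases hbs : b ∈ s
        · exact not_lt.1 fun h => hb ⟨hbs, h⟩
        · exact (hms b hbs).le
      nlinarith [hl.nonneg b]
  · refine support_subset_of_forall fun b hb => ?_
    simp only [Finset.mem_insert, Finset.mem_erase, not_or, not_and] at hb
    rw [Finsupp.sub_apply, Finsupp.smul_apply, smul_eq_mul]
    by_cases hbv : b = v
    · rw [hbv, hε, div_mul_cancel₀ _ hmv.ne', sub_self]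
    · rw [hl.eq_zero (hb.2 hbv), hms b (hb.2 hbv)]; simp
  · rw [map_add, map_sub, map_smul, hlx, hma, hom_single]; simp
  · have : heightSum ((l - ε • m) + single a ε) h =
        heightSum l h - ε * heightSum m h + ε * h a := by
      simp only [heightSum_apply, map_add, map_sub, map_smul,
        Finsupp.linearCombination_single, smul_eq_mul]
    rw [this]
    nlinarith

/-- The full-dimensional simplices with vertices in `A`. -/
noncomputable def fullSimplices (A : Finset E) : Finset (Finset E) :=
  A.powerset.filter fun s => AffineIndependent ℝ ((↑) : s → E) ∧
    s.card = Module.finrank ℝ E + 1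

lemma mem_fullSimplices {A s : Finset E} : s ∈ fullSimplices A ↔
    s ⊆ A ∧ AffineIndependent ℝ ((↑) : s → E) ∧ s.card = Module.finrank ℝ E + 1 := by
  simp [fullSimplices]

/-- Heights in general position for which `w` is far below the other points. -/
lemma exists_heights (A : Finset E) (w : E) (c : Finset E → E → E →₀ ℝ)
    (hc : ∀ s ∈ fullSimplices A, ∀ a, (c s a).support ⊆ s) :
    ∃ h : E → ℝ, (∀ s ∈ fullSimplices A, w ∉ s → h w < heightSum (c s w) h) ∧
      ∀ s ∈ fullSimplices A, ∀ a ∈ A, a ∉ s → heightSum (c s a) h ≠ h a := by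
  let C : Set (E → ℝ) := {h | ∀ s ∈ fullSimplices A, w ∉ s → h w < heightSum (c s w) h}
  let φ : Finset E × E → (E → ℝ) →ₗ[ℝ] ℝ := fun p => heightSum (c p.1 p.2) - LinearMap.proj p.2
  have hC : Convex ℝ C := by
    intro h hh h' hh' α β hα hβ hαβ s hs hw
    have h1 := hh s hs hw
    have h2 := hh' s hs hw
    rw [map_add, map_smul, map_smul, Pi.add_apply, Pi.smul_apply, Pi.smul_apply]
    simp only [smul_eq_mul]
    rcases hα.eq_or_lt with rfl | hα
    · have : β = 1 := by linarith
      subst this; simpa using h2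
    · nlinarith [mul_lt_mul_of_pos_left h1 hα, mul_le_mul_of_nonneg_left h2.le hβ]
  have hcz : ∀ s ∈ fullSimplices A, ∀ a b, b ∉ s → c s a b = 0 := fun s hs a b hb => by
    by_contra h0
    exact hb (hc s hs a (by simpa using h0))
  have h0 : Pi.single w (-1) ∈ C := by
    intro s hs hw
    rw [heightSum_single, hcz s hs w w hw]; simp
  obtain ⟨h, hhC, hh⟩ := exists_mem_forall_notMem hC ⟨_, h0⟩
    ((fullSimplices A ×ˢ A).filter fun p => p.2 ∉ p.1)
    (fun p => (LinearMap.ker (φ p)).toAffineSubspace) (by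
      rintro ⟨s, a⟩ hp
      simp only [Finset.mem_filter, Finset.mem_product] at hp
      obtain ⟨⟨hs, ha⟩, has⟩ := hp
      -- Lowering `w` alone is a witness unless `φ` vanishes there. In that case `a ≠ w`, and
      -- raising `a` by `1` makes `φ` equal to `-1`, while `M` exceeds every effect of this on the
      -- interpolations at `w`.
      by_cases h1 : φ (s, a) (Pi.single w (-1)) = 0
      · have haw : a ≠ w := by
          rintro rfl
          have h2 : heightSum (c s a) (Pi.single a (-1)) =
              (Pi.single a (-1) : E → ℝ) a := sub_eq_zero.1 h1
          rw [heightSum_single, hcz s hs a a has, Pi.single_eq_same] at h2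
          norm_num at h2
        have hcw : c s a w = 0 := by
          simpa [φ, heightSum_single, haw] using h1
        set M := 1 + ∑ s ∈ fullSimplices A, |c s w a| with hM
        refine ⟨Pi.single w (-M) + Pi.single a 1, ?_, ?_⟩
        · intro r hr hwr
          rw [map_add, heightSum_single, heightSum_single, hcz r hr w w hwr]
          have h2 := Finset.single_le_sum (f := fun s => |c s w a|)
            (fun s _ => abs_nonneg _) hr
          have h3 := neg_abs_le (c r w a)
          simp only [Pi.add_apply, Pi.single_eq_same, Pi.single_eq_of_ne haw.symm]
          linarith
        · intro h2
          have h3 : φ (s, a) (Pi.single w (-M) + Pi.single a 1) = 0 := h2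
          simp [φ, heightSum_single, hcw, hcz s hs a a has, haw] at h3
      · exact ⟨_, h0, h1⟩)
  refine ⟨h, hhC, fun s hs a ha has he => hh (s, a) (by simp [hs, ha, has]) ?_⟩
  change φ (s, a) h = 0
  simp [φ, he]

/-- Every finite spanning set has a face-to-face family of simplices covering its convex hull, all
of which contain a prescribed point. -/
lemma exists_pulling (A : Finset E) (hA : affineSpan ℝ (A : Set E) = ⊤) {w : E}
    (hwA : w ∈ A) :
    ∃ T : Finset (Finset E), (∀ s ∈ T, s ⊆ A ∧ s.card = Module.finrank ℝ E + 1 ∧ w ∈ s) ∧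
      (∀ s ∈ T, ∀ t ∈ T, ∀ l m : E →₀ ℝ, IsWeight s l → IsWeight t m → hom l = hom m → l = m) ∧
      convexHull ℝ (A : Set E) ⊆ ⋃ s ∈ T, convexHull ℝ (s : Set E) := by
  have hex : ∀ s a, ∃ l : E →₀ ℝ, s ∈ fullSimplices A → l.support ⊆ s ∧ hom l = (1, a) := by
    intro s a
    by_cases hs : s ∈ fullSimplices A
    · obtain ⟨-, h1, h2⟩ := mem_fullSimplices.1 hs
      obtain ⟨l, hl⟩ := exists_of_mem_affineSpan (s := s) (x := a)
        (by rw [affineSpan_eq_top_of_card h1 h2]; trivial)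
      exact ⟨l, fun _ => hl⟩
    · exact ⟨0, fun h => absurd h hs⟩
  choose c hc using hex
  obtain ⟨h, hw, hgen⟩ := exists_heights A w c fun s hs a => (hc s a hs).1
  -- These are the projections of the lower facets of the lifted point set.
  obtain ⟨T, hT⟩ : ∃ T : Finset (Finset E), ∀ s, s ∈ T ↔ s ∈ fullSimplices A ∧
      ∀ a ∈ A, a ∉ s → heightSum (c s a) h < h a :=
    ⟨(fullSimplices A).filter fun s => ∀ a ∈ A, a ∉ s → heightSum (c s a) h < h a, by simp⟩
  refine ⟨T, fun s hs => ?_, ?_, ?_⟩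
  · obtain ⟨hs, hslow⟩ := (hT s).1 hs
    obtain ⟨hsA, -, hcard⟩ := mem_fullSimplices.1 hs
    exact ⟨hsA, hcard, by_contra fun hws => (hw s hs hws).not_gt (hslow w hwA hws)⟩
  · intro s hs t ht l m hl hm hlm
    rw [hT] at hs ht
    obtain ⟨hs, hslow⟩ := hs
    obtain ⟨ht, htlow⟩ := ht
    obtain ⟨hsA, hsi, -⟩ := mem_fullSimplices.1 hs
    obtain ⟨htA, hti, -⟩ := mem_fullSimplices.1 ht
    -- Each weight minimises the height sum over its cell, so the two sums agree. Equality forces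
    -- the support of `m` into `s`.
    obtain ⟨h1, -⟩ := heightSum_le_of_lower hti (fun a => (hc t a ht).1) (fun a => (hc t a ht).2)
      htlow (hl.mono hsA) hm.support hlm
    obtain ⟨-, h2⟩ := heightSum_le_of_lower hsi (fun a => (hc s a hs).1) (fun a => (hc s a hs).2)
      hslow (hm.mono htA) hl.support hlm.symm
    exact hom_eq_iff_of_affineIndependent hsi hl.support (h2 h1) hlm
  · have hcl : IsClosed (⋃ s ∈ T, convexHull ℝ (s : Set E)) :=
      T.finite_toSet.isClosed_biUnion fun s _ => s.finite_toSet.isClosed_convexHull ℝ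
    -- The union of cells is closed, so it suffices to cover the dense set of points on no
    -- lower-dimensional span of points of `A`.
    refine (subset_closure_forall_notMem (convex_convexHull ℝ (A : Set E))
      (A.powerset.filter fun s : Finset E => affineSpan ℝ (s : Set E) ≠ ⊤)
      (fun s : Finset E => affineSpan ℝ (s : Set E)) ?_).trans (closure_minimal ?_ hcl)
    · intro s hs
      by_contra hno
      push Not at hno
      refine (Finset.mem_filter.1 hs).2 (top_unique (hA ▸ affineSpan_le.2 ?_))
      exact fun a ha => hno a (subset_convexHull ℝ _ ha)
    · rintro x ⟨hx, hxg⟩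
      have hxtop : ∀ s ⊆ A, x ∈ affineSpan ℝ (s : Set E) → affineSpan ℝ (s : Set E) = ⊤ := by
        intro s hs hxs
        by_contra hne
        exact hxg s (Finset.mem_filter.2 ⟨Finset.mem_powerset.2 hs, hne⟩) hxs
      have hne : ((fullSimplices A).filter fun s : Finset E =>
          x ∈ convexHull ℝ (s : Set E)).Nonempty := by
        rw [convexHull_eq_union] at hx
        simp only [Set.mem_iUnion] at hx
        obtain ⟨t, htA, hti, hxt⟩ := hx
        have htop := hxtop t (Finset.coe_subset.1 htA) (convexHull_subset_affineSpan _ hxt)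
        refine ⟨t, Finset.mem_filter.2 ⟨mem_fullSimplices.2 ⟨Finset.coe_subset.1 htA, hti, ?_⟩,
          hxt⟩⟩
        have := hti.affineSpan_eq_top_iff_card_eq_finrank_add_one.1
          (by simpa [Subtype.range_coe_subtype] using htop)
        simpa using this
      -- A simplex around `x` of least interpolated height at `x` is a lower cell: a point of `A`
      -- below it would allow a pivot decreasing that height. Genericity of `x` makes its weights
      -- positive, as the pivot needs.
      obtain ⟨s, hs, hmin⟩ := Finset.exists_min_image _ (fun s => heightSum (c s x) h) hne
      obtain ⟨hsf, hxs⟩ := Finset.mem_filter.1 hs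
      obtain ⟨hsA, hsi, hcard⟩ := mem_fullSimplices.1 hsf
      refine Set.mem_iUnion₂.2 ⟨s, (hT s).2 ⟨hsf, fun a ha has => ?_⟩, hxs⟩
      refine lt_of_le_of_ne ?_ (hgen s hsf a ha has)
      by_contra hlt
      obtain ⟨l, hl, hlx⟩ := mem_convexHull_iff_exists_weight.1 hxs
      have hlc : c s x = l := hom_eq_iff_of_affineIndependent hsi (hc s x hsf).1 hl.support
        ((hc s x hsf).2.trans hlx.symm)
      have hpos : ∀ v ∈ s, 0 < l v := by
        intro v hv
        refine lt_of_le_of_ne (hl.nonneg v) fun h0 => ?_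
        have hx' : x ∈ convexHull ℝ (s.erase v : Set E) := by
          refine mem_convexHull_iff_exists_weight.2 ⟨l, ⟨hl.nonneg, fun b hb => ?_⟩, hlx⟩
          refine Finset.mem_erase.2 ⟨?_, hl.support hb⟩
          rintro rfl
          exact (Finsupp.mem_support_iff.1 hb) h0.symm
        have := card_le_of_affineSpan_eq_top (hxtop (s.erase v)
          ((Finset.erase_subset _ _).trans hsA) (convexHull_subset_affineSpan _ hx'))
        rw [Finset.card_erase_of_mem hv] at this
        omega
      obtain ⟨s', hs'A, hs'i, hs'c, l', hl', hl'x, hlt'⟩ := exists_pivot hsA hsi hcard hl hlx hpos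
        ha has (hc s a hsf).1 (hc s a hsf).2 (not_le.1 hlt)
      have hs'f := mem_fullSimplices.2 ⟨hs'A, hs'i, hs'c⟩
      have := hmin s' (Finset.mem_filter.2 ⟨hs'f,
        mem_convexHull_iff_exists_weight.2 ⟨l', hl', hl'x⟩⟩)
      have hlc' : c s' x = l' := hom_eq_iff_of_affineIndependent hs'i (hc s' x hs'f).1 hl'.support
        ((hc s' x hs'f).2.trans hl'x.symm)
      rw [hlc, hlc'] at this
      linarith

end Regular

/-! ### Pulled triangulations and supporting hyperplanes. -/

section Pulling

open Finsupp
open scoped Classical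

variable {E : Type*} [NormedAddCommGroup E] [NormedSpace ℝ E] [DecidableEq E]

lemma mem_of_mem_extremePoints_convexHull {C s : Set E} {a : E} (ha : a ∈ C.extremePoints ℝ)
    (hs : convexHull ℝ s ⊆ C) (has : a ∈ convexHull ℝ s) : a ∈ s :=
  extremePoints_convexHull_subset
    (inter_extremePoints_subset_extremePoints_of_subset hs ⟨has, ha⟩)

lemma IsWeight.eq_of_le {s : Finset E} {l : E →₀ ℝ} {x : E} (hl : IsWeight s l)
    (hx : hom l = (1, x)) (f : E →ₗ[ℝ] ℝ) {b : ℝ} (hf : ∀ a ∈ s, f a ≤ b) (hfx : f x = b) :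
    ∀ a ∈ l.support, f a = b := by
  rw [hom_eq_sum (Finset.Subset.refl l.support), Prod.mk.injEq] at hx
  have hle : ∀ a ∈ l.support, l a * f a ≤ l a * b := fun a ha =>
    mul_le_mul_of_nonneg_left (hf a (hl.support ha)) (hl.nonneg a)
  have he : ∑ a ∈ l.support, l a * f a = ∑ a ∈ l.support, l a * b := by
    rw [← Finset.sum_mul, hx.1, one_mul, ← hfx, ← hx.2, map_sum]
    simp
  intro a ha
  exact mul_left_cancel₀ (Finsupp.mem_support_iff.1 ha)
    ((Finset.sum_eq_sum_iff_of_le hle).1 he a ha)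

lemma finrank_vectorSpan_add_one_le {s : Finset E} (hs : s.Nonempty) :
    Module.finrank ℝ (vectorSpan ℝ (s : Set E)) + 1 ≤ s.card := by
  have := hs.card_pos
  have h1 := finrank_vectorSpan_image_finset_le ℝ (id : E → E) s
    (n := s.card - 1) (by omega)
  rw [Finset.image_id] at h1
  omega

lemma finrank_vectorSpan_of_affineIndependent {G : Finset E} (hne : G.Nonempty)
    (hG : AffineIndependent ℝ ((↑) : G → E)) :
    Module.finrank ℝ (vectorSpan ℝ (G : Set E)) + 1 = G.card := by
  have := hne.to_subtype
  have h1 := hG.finrank_vectorSpan_add_one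
  rw [Subtype.range_coe_subtype] at h1
  simpa using h1

lemma vectorSpan_convexHull (s : Set E) : vectorSpan ℝ (convexHull ℝ s) = vectorSpan ℝ s := by
  rw [← direction_affineSpan, affineSpan_convexHull, direction_affineSpan]

variable [FiniteDimensional ℝ E]

/-- No point of `A` is missed: an extreme point is a vertex of any cell covering it, and `w` is in
all cells. -/
lemma exists_isTri_pulling {A : Finset E} (hA : affineSpan ℝ (A : Set E) = ⊤) {w : E} (hw : w ∈ A)
    (hext : ∀ a ∈ A, a ≠ w → a ∈ (convexHull ℝ (A : Set E)).extremePoints ℝ) :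
    ∃ T, IsTri (A : Set E) T ∧ ∀ s ∈ T, w ∈ s := by
  obtain ⟨T, hT, hu, hc⟩ := exists_pulling A hA hw
  refine ⟨T, ⟨hu, fun s hs => ?_, ?_, hc⟩, fun s hs => (hT s hs).2.2⟩
  · rw [(hT s hs).2.1, ← direction_affineSpan, hA, AffineSubspace.direction_top, finrank_top]
  · apply Set.Subset.antisymm
    · exact Set.iUnion₂_subset fun s hs => Finset.coe_subset.2 (hT s hs).1
    · intro a ha
      obtain ⟨s, hs, has⟩ := Set.mem_iUnion₂.1 (hc (subset_convexHull ℝ _ ha))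
      refine Set.mem_iUnion₂.2 ⟨s, hs, ?_⟩
      by_cases haw : a = w
      · rw [haw]; exact (hT s hs).2.2
      · exact mem_of_mem_extremePoints_convexHull (hext a ha haw)
          (convexHull_mono (Finset.coe_subset.2 (hT s hs).1)) has

/-- If `w` is an interior point lying in every cell, the facets opposite to `w` lie in supporting
hyperplanes. -/
lemma IsTri.exists_supporting {A : Set E} {T : Finset (Finset E)} (h : IsTri A T) {w : E}
    (hw : w ∈ interior (convexHull ℝ A)) (hwT : ∀ s ∈ T, w ∈ s) {s : Finset E} (hs : s ∈ T)
    (hne : (s.erase w).Nonempty) :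
    ∃ (f : E →L[ℝ] ℝ) (b : ℝ), f ≠ 0 ∧ (∀ x ∈ convexHull ℝ A, f x ≤ b) ∧
      ∀ a ∈ s.erase w, f a = b := by
  obtain ⟨l, g, hl, hlg, hpos⟩ := exists_uniform_weight hne
  have hg : g ∈ convexHull ℝ (s.erase w : Set E) := mem_convexHull_iff_exists_weight.2 ⟨l, hl, hlg⟩
  -- Otherwise a neighbouring cell would contain the facet opposite `w` and also `w`, hence equal
  -- `s`.
  have hgi : g ∉ interior (convexHull ℝ A) := by
    intro hgi
    obtain ⟨t, ht, hts, hst⟩ := h.exists_adjacent hs (hwT s hs) hg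
      (interior_subset_intrinsicInterior hgi)
    refine hts (Finset.eq_of_subset_of_card_le (fun a ha => ?_)
      (by rw [h.card_eq s hs, h.card_eq t ht])).symm
    by_cases haw : a = w
    · rw [haw]; exact hwT t ht
    · exact hst (Finset.mem_erase.2 ⟨haw, ha⟩)
  obtain ⟨f, hf⟩ := geometric_hahn_banach_open_point (convex_convexHull ℝ A).interior
    isOpen_interior hgi
  have hle : ∀ x ∈ convexHull ℝ A, f x ≤ f g := by
    intro x hx
    have hx' : x ∈ closure (interior (convexHull ℝ A)) := by
      rw [(convex_convexHull ℝ A).closure_interior_eq_closure_of_nonempty_interior ⟨w, hw⟩]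
      exact subset_closure hx
    exact closure_minimal (fun y hy => (hf y hy).le)
      (isClosed_le f.continuous continuous_const) hx'
  refine ⟨f, f g, ?_, hle, fun a ha => ?_⟩
  · rintro rfl
    simpa using hf w hw
  · refine hl.eq_of_le hlg (f : E →ₗ[ℝ] ℝ) (fun a ha => hle a (subset_convexHull ℝ A
      (h.subset hs (Finset.mem_of_mem_erase ha)))) rfl a ?_
    exact Finsupp.mem_support_iff.2 (hpos a ha).ne'

end Pulling

/-! ### The link of the interior point triangulates the facets. -/

section Facets

open scoped Classical

variable {d : ℕ}

lemma convexHull_inter_eq_of_supporting {V : Finset (EuclideanSpace ℝ (Fin d))}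
    {a : EuclideanSpace ℝ (Fin d)} {b : ℝ} (h : ∀ x ∈ convexHull ℝ (V : Set _), inner ℝ a x ≤ b) :
    convexHull ℝ ((V : Set (EuclideanSpace ℝ (Fin d))) ∩
      {x ∈ convexHull ℝ (V : Set _) | inner ℝ a x = b}) =
      {x ∈ convexHull ℝ (V : Set _) | inner ℝ a x = b} := by
  apply Set.Subset.antisymm
  · refine convexHull_min Set.inter_subset_right ?_
    exact (convex_convexHull ℝ _).inter (convex_hyperplane (innerₗ _ a).isLinear b)
  · rintro x ⟨hx, hxb⟩
    obtain ⟨l, hl, hlx⟩ := mem_convexHull_iff_exists_weight.1 hx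
    have hs := hl.eq_of_le hlx (innerₗ _ a) (fun y hy => h y (subset_convexHull ℝ _ hy)) hxb
    have : x ∈ convexHull ℝ ((V.filter fun y => inner ℝ a y = b : Finset _) : Set _) :=
      mem_convexHull_iff_exists_weight.2 ⟨l, ⟨hl.nonneg, fun y hy =>
        Finset.mem_filter.2 ⟨hl.support hy, hs y hy⟩⟩, hlx⟩
    refine convexHull_mono (fun y hy => ?_) this
    have := Finset.mem_filter.1 (Finset.mem_coe.1 hy)
    exact ⟨this.1, subset_convexHull ℝ _ this.1, this.2⟩

lemma inner_lt_of_mem_interior {P : Set (EuclideanSpace ℝ (Fin d))}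
    {a w : EuclideanSpace ℝ (Fin d)} {b : ℝ} (ha : a ≠ 0) (h : ∀ x ∈ P, inner ℝ a x ≤ b)
    (hw : w ∈ interior P) : inner ℝ a w < b := by
  have hf : Continuous fun t : ℝ => w + t • a := by fun_prop
  have : ∀ᶠ t in nhds (0 : ℝ), w + t • a ∈ interior P :=
    hf.continuousAt.eventually_mem (isOpen_interior.mem_nhds (by simpa using hw))
  obtain ⟨δ, hδ, hb⟩ := Metric.eventually_nhds_iff.1 this
  have h1 := h _ (interior_subset (hb (y := δ / 2) (by
    rw [Real.dist_eq, sub_zero, abs_of_pos] <;> linarith)))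
  rw [inner_add_right, inner_smul_right] at h1
  have h2 : 0 < inner ℝ a a := by rwa [real_inner_self_pos]
  nlinarith

lemma extremePoints_facet {V : Finset (EuclideanSpace ℝ (Fin d))}
    {P F : Set (EuclideanSpace ℝ (Fin d))} (hV : (V : Set _) = P.extremePoints ℝ)
    (hP : P = convexHull ℝ (V : Set _)) (hF : IsFacet P F) :
    F.extremePoints ℝ = (V : Set _) ∩ F ∧ convexHull ℝ ((V : Set _) ∩ F) = F := by
  obtain ⟨⟨a, b, ha, hle, hFe⟩, -, -⟩ := hF
  have h1 : convexHull ℝ ((V : Set _) ∩ F) = F := by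
    rw [hFe, hP]
    exact convexHull_inter_eq_of_supporting (fun x hx => hle x (hP ▸ hx))
  refine ⟨?_, h1⟩
  apply Set.Subset.antisymm
  · intro x hx
    rw [← h1] at hx
    exact extremePoints_convexHull_subset hx
  · rintro x ⟨hx, hxF⟩
    rw [hV] at hx
    exact inter_extremePoints_subset_extremePoints_of_subset (by rw [hFe]; exact fun y hy => hy.1)
      ⟨hxF, hx⟩

/-- The cells of the link of `w` contained in `F`. -/
noncomputable def linkIn (T : Finset (Finset (EuclideanSpace ℝ (Fin d))))
    (w : EuclideanSpace ℝ (Fin d)) (F : Set (EuclideanSpace ℝ (Fin d))) :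
    Finset (Finset (EuclideanSpace ℝ (Fin d))) :=
  (T.image fun s => s.erase w).filter fun s => (s : Set (EuclideanSpace ℝ (Fin d))) ⊆ F

lemma mem_linkIn {T : Finset (Finset (EuclideanSpace ℝ (Fin d)))}
    {w : EuclideanSpace ℝ (Fin d)} {F : Set (EuclideanSpace ℝ (Fin d))}
    {G : Finset (EuclideanSpace ℝ (Fin d))} :
    G ∈ linkIn T w F ↔ (∃ s ∈ T, s.erase w = G) ∧ (G : Set (EuclideanSpace ℝ (Fin d))) ⊆ F := by
  simp [linkIn]

/-- Uniqueness is inherited from `T`. For the covering, a generic point of `F` avoids the spans of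
the lower-dimensional traces of cells on `F`. The cell carrying it therefore has its whole face
opposite `w` in `F`, and closedness handles the remaining points. -/
lemma isTri_linkIn {V : Finset (EuclideanSpace ℝ (Fin d))}
    {P F : Set (EuclideanSpace ℝ (Fin d))} (hV : (V : Set _) = P.extremePoints ℝ)
    (hP : P = convexHull ℝ (V : Set _)) {w : EuclideanSpace ℝ (Fin d)} (hw : w ∈ interior P)
    {T : Finset (Finset (EuclideanSpace ℝ (Fin d)))}
    (hT : IsTri (insert w (V : Set (EuclideanSpace ℝ (Fin d)))) T) (hwT : ∀ s ∈ T, w ∈ s)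
    (hcard : ∀ s ∈ T, s.card = d + 1) (hF : IsFacet P F) :
    IsTri (F.extremePoints ℝ) (linkIn T w F) := by
  obtain ⟨hext, hconv⟩ := extremePoints_facet hV hP hF
  obtain ⟨⟨a, b, ha, hle, hFe⟩, hFne, hFd⟩ := hF
  have hwF : w ∉ F := by
    rw [hFe]; exact fun h => (inner_lt_of_mem_interior ha hle hw).ne h.2
  have hFP : F ⊆ P := by rw [hFe]; exact fun x hx => hx.1
  have hAP : (insert w (V : Set (EuclideanSpace ℝ (Fin d)))) ⊆ P := by
    refine Set.insert_subset (interior_subset hw) ?_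
    conv_rhs => rw [hP]
    exact subset_convexHull ℝ _
  have hPA : P ⊆ convexHull ℝ (insert w (V : Set (EuclideanSpace ℝ (Fin d)))) := by
    conv_lhs => rw [hP]
    exact convexHull_mono (Set.subset_insert _ _)
  have hFc : Convex ℝ F := by rw [← hconv]; exact convex_convexHull ℝ _
  have hcov : F ⊆ ⋃ G ∈ linkIn T w F, convexHull ℝ (G : Set (EuclideanSpace ℝ (Fin d))) := by
    have hcl : IsClosed (⋃ G ∈ linkIn T w F, convexHull ℝ (G : Set (EuclideanSpace ℝ (Fin d)))) :=
      (linkIn T w F).finite_toSet.isClosed_biUnion fun s _ =>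
        s.finite_toSet.isClosed_convexHull ℝ
    refine (subset_closure_forall_notMem hFc
      (T.filter fun s => ¬ ((s.erase w : Finset _) : Set (EuclideanSpace ℝ (Fin d))) ⊆ F)
      (fun s => affineSpan ℝ ((s.filter fun x => x ∈ F : Finset _) :
        Set (EuclideanSpace ℝ (Fin d)))) ?_).trans (closure_minimal ?_ hcl)
    · intro s hs
      obtain ⟨hs, hsF⟩ := Finset.mem_filter.1 hs
      by_contra hno
      push Not at hno
      have hle2 : affineSpan ℝ F ≤ affineSpan ℝ ((s.filter fun x => x ∈ F : Finset _) :
        Set (EuclideanSpace ℝ (Fin d))) := affineSpan_le.2 hno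
      have hne : (s.filter fun x => x ∈ F).Nonempty := by
        obtain ⟨x, hx⟩ := hFne
        have := (affineSpan_nonempty ℝ).1 ⟨x, hno x hx⟩
        exact_mod_cast this
      have h1 := finrank_vectorSpan_add_one_le hne
      have h2 := Submodule.finrank_mono (AffineSubspace.direction_le hle2)
      rw [direction_affineSpan, direction_affineSpan] at h2
      -- The trace lies properly inside the `d` vertices other than `w`, too few to span `F`.
      have h3 : (s.filter fun x => x ∈ F).card < (s.erase w).card := by
        refine Finset.card_lt_card ⟨fun x hx => ?_, fun hsub => hsF fun x hx => ?_⟩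
        · obtain ⟨hx, hxF⟩ := Finset.mem_filter.1 hx
          refine Finset.mem_erase.2 ⟨?_, hx⟩
          rintro rfl; exact hwF hxF
        · exact (Finset.mem_filter.1 (hsub hx)).2
      rw [Finset.card_erase_of_mem (hwT s hs), hcard s hs] at h3
      omega
    · rintro x ⟨hx, hxg⟩
      obtain ⟨s, hs, l, hl, hlx⟩ := hT.exists_carrier (hPA (hFP hx))
      have hxb : inner ℝ a x = b := by rw [hFe] at hx; exact hx.2
      have hsup := hl.eq_of_le hlx (innerₗ _ a) (fun y hy => hle y (hAP (hT.subset hs hy))) hxb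
      have hsupF : ∀ y ∈ l.support, y ∈ F := fun y hy => by
        rw [hFe]; exact ⟨hAP (hT.subset hs (hl.support hy)), hsup y hy⟩
      have hsF : ((s.erase w : Finset _) : Set (EuclideanSpace ℝ (Fin d))) ⊆ F := by
        by_contra hsF
        refine hxg s (Finset.mem_filter.2 ⟨hs, hsF⟩) (convexHull_subset_affineSpan _ ?_)
        exact mem_convexHull_iff_exists_weight.2 ⟨l, ⟨hl.nonneg, fun y hy =>
          Finset.mem_filter.2 ⟨hl.support hy, hsupF y hy⟩⟩, hlx⟩
      refine Set.mem_iUnion₂.2 ⟨s.erase w, mem_linkIn.2 ⟨⟨s, hs, rfl⟩, hsF⟩, ?_⟩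
      refine mem_convexHull_iff_exists_weight.2 ⟨l, ⟨hl.nonneg, fun y hy =>
          Finset.mem_erase.2 ⟨?_, hl.support hy⟩⟩, hlx⟩
      rintro rfl; exact hwF (hsupF _ hy)
  have hconv' : convexHull ℝ (F.extremePoints ℝ) = F := by rw [hext, hconv]
  refine ⟨?_, ?_, ?_, by rwa [hconv']⟩
  · intro G hG G' hG' l m hl hm hlm
    obtain ⟨⟨s, hs, rfl⟩, -⟩ := mem_linkIn.1 hG
    obtain ⟨⟨s', hs', rfl⟩, -⟩ := mem_linkIn.1 hG'
    exact hT.unique s hs s' hs' l m (hl.mono (Finset.erase_subset _ _))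
      (hm.mono (Finset.erase_subset _ _)) hlm
  · intro G hG
    obtain ⟨⟨s, hs, rfl⟩, -⟩ := mem_linkIn.1 hG
    rw [← vectorSpan_convexHull, hconv', hFd, Finset.card_erase_of_mem (hwT s hs), hcard s hs]
    rfl
  · apply Set.Subset.antisymm
    · refine Set.iUnion₂_subset fun G hG => ?_
      obtain ⟨⟨s, hs, rfl⟩, hsF⟩ := mem_linkIn.1 hG
      rw [hext]
      refine fun x hx => ⟨?_, hsF hx⟩
      have hx' := Finset.mem_erase.1 (Finset.mem_coe.1 hx)
      exact (hT.subset hs hx'.2).resolve_left hx'.1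
    · intro x hx
      obtain ⟨G, hG, hxG⟩ := Set.mem_iUnion₂.1 (hcov hx.1)
      refine Set.mem_iUnion₂.2 ⟨G, hG, mem_of_mem_extremePoints_convexHull hx ?_ hxG⟩
      exact convexHull_min (mem_linkIn.1 hG).2 hFc

/-- The supporting hyperplane of `exists_supporting` contains the `d` affinely independent vertices
other than `w`, so the face it cuts out has dimension exactly `d - 1`. -/
lemma exists_facet_of_mem {V : Finset (EuclideanSpace ℝ (Fin d))} (hd : 1 ≤ d)
    {P : Set (EuclideanSpace ℝ (Fin d))}
    (hP : P = convexHull ℝ (V : Set _)) {w : EuclideanSpace ℝ (Fin d)} (hw : w ∈ interior P)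
    {T : Finset (Finset (EuclideanSpace ℝ (Fin d)))}
    (hT : IsTri (insert w (V : Set (EuclideanSpace ℝ (Fin d)))) T) (hwT : ∀ s ∈ T, w ∈ s)
    (hcard : ∀ s ∈ T, s.card = d + 1) {s : Finset (EuclideanSpace ℝ (Fin d))} (hs : s ∈ T) :
    ∃ F, IsFacet P F ∧ s.erase w ∈ linkIn T w F := by
  have hPA : convexHull ℝ (insert w (V : Set (EuclideanSpace ℝ (Fin d)))) = P := by
    apply Set.Subset.antisymm
    · refine convexHull_min (Set.insert_subset (interior_subset hw) ?_) ?_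
      · rw [hP]; exact subset_convexHull ℝ _
      · rw [hP]; exact convex_convexHull ℝ _
    · conv_lhs => rw [hP]
      exact convexHull_mono (Set.subset_insert _ _)
  have hcard' : (s.erase w).card = d := by
    rw [Finset.card_erase_of_mem (hwT s hs), hcard s hs]; rfl
  have hne : (s.erase w).Nonempty := Finset.card_pos.1 (by omega)
  obtain ⟨f, b, hf0, hfle, hfb⟩ := hT.exists_supporting (by rwa [hPA]) hwT hs hne
  rw [hPA] at hfle
  set a := (InnerProductSpace.toDual ℝ (EuclideanSpace ℝ (Fin d))).symm f with ha
  have hfa : ∀ x, inner ℝ a x = f x := fun x => by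
    rw [ha, InnerProductSpace.toDual_symm_apply]
  have ha0 : a ≠ 0 := by simpa [ha] using hf0
  have hsub : ((s.erase w : Finset _) : Set (EuclideanSpace ℝ (Fin d))) ⊆
      {x ∈ P | inner ℝ a x = b} := by
    intro x hx
    refine ⟨?_, by rw [hfa, hfb x hx]⟩
    rw [← hPA]
    exact subset_convexHull ℝ _ (hT.subset hs (Finset.mem_of_mem_erase hx))
  refine ⟨{x ∈ P | inner ℝ a x = b}, ⟨⟨a, b, ha0, fun x hx => by rw [hfa]; exact hfle x hx, rfl⟩,
    ?_, ?_⟩, mem_linkIn.2 ⟨⟨s, hs, rfl⟩, hsub⟩⟩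
  · exact (Finset.coe_nonempty.2 hne).mono hsub
  · have hle : Module.finrank ℝ (vectorSpan ℝ {x ∈ P | inner ℝ a x = b}) < d := by
      have h1 : vectorSpan ℝ {x ∈ P | inner ℝ a x = b} ≤ LinearMap.ker (f : _ →ₗ[ℝ] ℝ) := by
        rw [vectorSpan_def, Submodule.span_le]
        rintro _ ⟨x, hx, y, hy, rfl⟩
        have h2 := hx.2
        have h3 := hy.2
        rw [hfa] at h2 h3
        simp [h2, h3]
      have h2 : LinearMap.ker (f : EuclideanSpace ℝ (Fin d) →ₗ[ℝ] ℝ) < ⊤ := by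
        rw [lt_top_iff_ne_top, Ne, LinearMap.ker_eq_top]
        intro h; exact hf0 (by ext x; simpa using LinearMap.congr_fun h x)
      have h3 := Submodule.finrank_lt h2.ne
      rw [finrank_euclideanSpace_fin] at h3
      exact (Submodule.finrank_mono h1).trans_lt h3
    have hge : d ≤ Module.finrank ℝ (vectorSpan ℝ {x ∈ P | inner ℝ a x = b}) + 1 := by
      have h1 := finrank_vectorSpan_of_affineIndependent hne
        (affineIndependent_iff_hom.2 fun l hl =>
          affineIndependent_iff_hom.1 (hT.affineIndependent hs) l
            (hl.trans (Finset.erase_subset _ _)))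
      have h2 := Submodule.finrank_mono (vectorSpan_mono ℝ hsub)
      omega
    omega

end Facets

/-! ### Volume of lattice simplices. -/

section Volume

open MeasureTheory
open scoped Classical

/-- The corner simplex cut off from the nonnegative orthant. -/
def cornerSimplex (d : ℕ) : Set (Fin d → ℝ) := {x | (∀ i, 0 ≤ x i) ∧ ∑ i, x i ≤ 1}

/-- The `ℓ¹` unit ball has volume `2 ^ d / d!` and is covered by the `2 ^ d` reflected copies of the
corner simplex. -/
lemma le_volume_cornerSimplex (d : ℕ) :
    ENNReal.ofReal (1 / (Nat.factorial d : ℝ)) ≤ volume (cornerSimplex d) := by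
  let M : (Fin d → Bool) → Matrix (Fin d) (Fin d) ℝ :=
    fun σ => Matrix.diagonal fun i => if σ i then 1 else -1
  have hM : ∀ σ, volume (Matrix.toLin' (M σ) '' cornerSimplex d) = volume (cornerSimplex d) := by
    intro σ
    rw [Measure.addHaar_image_linearMap, LinearMap.det_toLin', Matrix.det_diagonal,
      Finset.abs_prod, Finset.prod_eq_one, ENNReal.ofReal_one, one_mul]
    intro i _
    split_ifs <;> simp
  have hsub : {x : Fin d → ℝ | ∑ i, |x i| ^ (1 : ℝ) < 1} ⊆
      ⋃ σ ∈ (Finset.univ : Finset (Fin d → Bool)), Matrix.toLin' (M σ) '' cornerSimplex d := by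
    intro x hx
    refine Set.mem_iUnion₂.2 ⟨fun i => decide (0 ≤ x i), Finset.mem_univ _, fun i => |x i|,
      ⟨fun i => abs_nonneg _, by
        have h : ∑ i, |x i| ^ (1 : ℝ) < 1 := hx
        simpa using h.le⟩, ?_⟩
    ext i
    rw [Matrix.toLin'_apply, Matrix.mulVec_diagonal]
    by_cases h : 0 ≤ x i
    · simp [h]
    · simp [h, abs_of_neg (not_le.1 h)]
  have h1 := (measure_mono hsub).trans (measure_biUnion_finset_le (μ := volume) _ _)
  rw [volume_sum_rpow_lt_one _ le_rfl] at h1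
  simp only [hM, Finset.sum_const, Finset.card_univ, Fintype.card_fun, Fintype.card_bool,
    Fintype.card_fin, div_one, Real.Gamma_nat_eq_factorial, nsmul_eq_mul] at h1
  have hG : Real.Gamma (1 + 1) = 1 := by norm_num [Real.Gamma_two]
  rw [hG, mul_one] at h1
  have h2 : ENNReal.ofReal (2 ^ d / (Nat.factorial d : ℝ)) =
      ((2 ^ d : ℕ) : ENNReal) * ENNReal.ofReal (1 / (Nat.factorial d : ℝ)) := by
    rw [div_eq_mul_one_div, ENNReal.ofReal_mul (by positivity)]
    congr 1
    rw [← ENNReal.ofReal_natCast]; push_cast; rfl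
  rw [h2] at h1
  exact (ENNReal.mul_le_mul_iff_right (by positivity) (ENNReal.natCast_ne_top _)).1 h1

variable {d : ℕ}

/-- The edge matrix is integral, and a kernel vector would be an affine dependence, so the
determinant is a nonzero integer. -/
lemma one_le_abs_det {v : Fin (d + 1) → EuclideanSpace ℝ (Fin d)} (hv : ∀ i, v i ∈ latticePoints d)
    (hi : AffineIndependent ℝ v) :
    1 ≤ |(Matrix.of fun j i : Fin d => v i.succ j - v 0 j).det| := by
  set M : Matrix (Fin d) (Fin d) ℝ := Matrix.of fun j i => v i.succ j - v 0 j with hM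
  have h0 : M.det ≠ 0 := by
    intro h0
    obtain ⟨y, hy, hMy⟩ := Matrix.exists_mulVec_eq_zero_iff.2 h0
    refine hy (funext fun i => ?_)
    have := affineIndependent_iff.1 hi Finset.univ (Fin.cons (-∑ i, y i) y)
      (by rw [Fin.sum_univ_succ]; simp) (by
        rw [Fin.sum_univ_succ]
        simp only [Fin.cons_zero, Fin.cons_succ]
        ext j
        have h1 := congrFun hMy j
        simp only [Matrix.mulVec, dotProduct, hM, Matrix.of_apply, Pi.zero_apply, sub_mul,
          Finset.sum_sub_distrib, ← Finset.mul_sum] at h1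
        simp only [PiLp.add_apply, PiLp.smul_apply, smul_eq_mul, PiLp.zero_apply, WithLp.ofLp_sum,
          Finset.sum_apply, WithLp.ofLp_smul, Pi.smul_apply, neg_mul]
        rw [← h1, Finset.sum_congr rfl fun i _ => mul_comm (v i.succ j) (y i)]
        ring) i.succ (Finset.mem_univ _)
    simpa using this
  choose n hn using hv
  have h1 : M = (Matrix.of fun j i : Fin d => n i.succ j - n 0 j).map (Int.cast : ℤ → ℝ) := by
    ext j i
    simp [hM, hn]
  rw [h1, ← Int.cast_det] at h0 ⊢
  rw [← Int.cast_abs]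
  exact_mod_cast Int.one_le_abs (by exact_mod_cast h0)

/-- The simplex contains the translated image of the corner simplex under its edge matrix. -/
lemma le_volume_lattice_simplex {s : Finset (EuclideanSpace ℝ (Fin d))}
    (hs : (s : Set _) ⊆ latticePoints d)
    (hi : AffineIndependent ℝ ((↑) : s → EuclideanSpace ℝ (Fin d))) (hc : s.card = d + 1) :
    ENNReal.ofReal (1 / (Nat.factorial d : ℝ)) ≤
      volume (convexHull ℝ (s : Set (EuclideanSpace ℝ (Fin d)))) := by
  let e := s.equivFinOfCardEq hc
  let v : Fin (d + 1) → EuclideanSpace ℝ (Fin d) := fun i => (e.symm i : EuclideanSpace ℝ (Fin d))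
  have hv : ∀ i, v i ∈ s := fun i => (e.symm i).2
  have hdet := one_le_abs_det (v := v) (fun i => hs (hv i))
    (hi.comp_embedding e.symm.toEmbedding)
  set M : Matrix (Fin d) (Fin d) ℝ := Matrix.of fun j i => v i.succ j - v 0 j with hM
  have hsub : (fun y : Fin d → ℝ => WithLp.ofLp (v 0) + y) '' (Matrix.toLin' M '' cornerSimplex d) ⊆
      WithLp.toLp 2 ⁻¹' convexHull ℝ (s : Set (EuclideanSpace ℝ (Fin d))) := by
    rintro _ ⟨_, ⟨y, ⟨hy0, hy1⟩, rfl⟩, rfl⟩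
    have h := (convex_convexHull ℝ (s : Set (EuclideanSpace ℝ (Fin d)))).sum_mem
      (t := Finset.univ) (w := Fin.cons (1 - ∑ i, y i) y) (z := v) (fun i _ => by
        refine Fin.cases ?_ (fun i => ?_) i
        · simpa using hy1
        · simpa using hy0 i) (by rw [Fin.sum_univ_succ]; simp)
      (fun i _ => subset_convexHull ℝ _ (hv i))
    rw [Fin.sum_univ_succ] at h
    simp only [Fin.cons_zero, Fin.cons_succ] at h
    rw [Set.mem_preimage]
    convert h using 1
    ext j
    simp only [Matrix.toLin'_apply, Matrix.mulVec, dotProduct, hM, Matrix.of_apply, Pi.add_apply,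
      sub_mul, Finset.sum_sub_distrib, ← Finset.mul_sum, PiLp.add_apply, PiLp.smul_apply,
      smul_eq_mul, WithLp.ofLp_sum, Finset.sum_apply, WithLp.ofLp_smul, Pi.smul_apply, one_mul]
    rw [Finset.sum_congr rfl fun i _ => mul_comm (v i.succ j) (y i)]
    ring
  have hcl : IsClosed (convexHull ℝ (s : Set (EuclideanSpace ℝ (Fin d)))) :=
    s.finite_toSet.isClosed_convexHull ℝ
  have hvol := measure_mono (μ := volume) hsub
  rw [(PiLp.volume_preserving_toLp (Fin d)).measure_preimage
    hcl.measurableSet.nullMeasurableSet, Set.image_add_left, measure_preimage_add,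
    Measure.addHaar_image_linearMap, LinearMap.det_toLin'] at hvol
  refine (le_volume_cornerSimplex d).trans (le_trans ?_ hvol)
  exact le_mul_of_one_le_left (zero_le) (by simpa using ENNReal.ofReal_le_ofReal hdet)

/-- The interiors of the cells are disjoint, and each has the full volume of its cell because
boundaries of convex sets are null. -/
lemma card_div_factorial_le_volume {A : Set (EuclideanSpace ℝ (Fin d))}
    {T : Finset (Finset (EuclideanSpace ℝ (Fin d)))} (hT : IsTri A T) (hA : A ⊆ latticePoints d)
    (hcard : ∀ s ∈ T, s.card = d + 1) :
    (T.card : ℝ) / (Nat.factorial d : ℝ) ≤ (volume (convexHull ℝ A)).toReal := by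
  have h1 : volume (⋃ s ∈ T, interior (convexHull ℝ (s : Set (EuclideanSpace ℝ (Fin d))))) =
      ∑ s ∈ T, volume (interior (convexHull ℝ (s : Set (EuclideanSpace ℝ (Fin d))))) :=
    measure_biUnion_finset (fun s hs t ht hst =>
      (hT.disjoint_intrinsicInterior hs ht hst).mono interior_subset_intrinsicInterior
        interior_subset_intrinsicInterior) fun s _ => isOpen_interior.measurableSet
  have h2 : ∀ s ∈ T, ENNReal.ofReal (1 / (Nat.factorial d : ℝ)) ≤
      volume (interior (convexHull ℝ (s : Set (EuclideanSpace ℝ (Fin d))))) := fun s hs => by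
    rw [measure_congr (interior_ae_eq_of_null_frontier
      ((convex_convexHull ℝ (s : Set (EuclideanSpace ℝ (Fin d)))).addHaar_frontier volume))]
    exact le_volume_lattice_simplex ((hT.subset hs).trans hA) (hT.affineIndependent hs)
      (hcard s hs)
  have h3 : (T.card : ENNReal) * ENNReal.ofReal (1 / (Nat.factorial d : ℝ)) ≤
      volume (convexHull ℝ A) := by
    rw [← nsmul_eq_mul]
    refine (Finset.card_nsmul_le_sum T _ _ h2).trans (h1 ▸ measure_mono ?_)
    exact Set.iUnion₂_subset fun s hs =>
      interior_subset.trans (convexHull_mono (hT.subset hs))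
  have hfin : volume (convexHull ℝ A) ≠ ⊤ :=
    (hT.finite.isCompact_convexHull ℝ).measure_lt_top.ne
  have h4 := ENNReal.toReal_mono hfin h3
  rw [ENNReal.toReal_mul, ENNReal.toReal_natCast, ENNReal.toReal_ofReal (by positivity)] at h4
  rwa [div_eq_mul_one_div]

end Volume

/-! ### Refinement sequences and their lengths. -/

section Main

open scoped Classical

variable {d : ℕ}

lemma finite_inter_latticePoints {P : Set (EuclideanSpace ℝ (Fin d))}
    (hP : Bornology.IsBounded P) : (P ∩ latticePoints d).Finite := by
  obtain ⟨R, hR⟩ := hP.exists_norm_le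
  refine ((Fintype.piFinset fun _ : Fin d => Finset.Icc (-⌈R⌉) ⌈R⌉).finite_toSet.image
    fun m => WithLp.toLp 2 fun i => (m i : ℝ)).subset ?_
  rintro x ⟨hx, hxl⟩
  choose m hm using hxl
  refine ⟨m, ?_, ?_⟩
  · rw [Finset.mem_coe, Fintype.mem_piFinset]
    intro i
    have h1 : |(m i : ℝ)| ≤ ⌈R⌉ := by
      rw [← hm i, ← Real.norm_eq_abs]
      exact (PiLp.norm_apply_le x i).trans ((hR x hx).trans (Int.le_ceil R))
    rw [Finset.mem_Icc]
    rw [abs_le] at h1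
    exact ⟨by exact_mod_cast h1.1, by exact_mod_cast h1.2⟩
  · ext i
    exact (hm i).symm

/-- The vertices and the lattice points of a lattice polytope, as finite sets. -/
lemma IsLatticePolytope.exists_finset {P : Set (EuclideanSpace ℝ (Fin d))}
    (hP : IsLatticePolytope P) : ∃ V L : Finset (EuclideanSpace ℝ (Fin d)),
      (V : Set _) = P.extremePoints ℝ ∧ P = convexHull ℝ (V : Set _) ∧
      affineSpan ℝ (V : Set (EuclideanSpace ℝ (Fin d))) = ⊤ ∧
      (L : Set _) = P ∩ latticePoints d ∧ V ⊆ L := by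
  obtain ⟨⟨A, hAf, hAl, hPA⟩, hspan⟩ := hP
  have hcpt : IsCompact P := hPA ▸ hAf.isCompact_convexHull ℝ
  have hconv : Convex ℝ P := hPA ▸ convex_convexHull ℝ A
  have hVA : P.extremePoints ℝ ⊆ A := hPA ▸ extremePoints_convexHull_subset
  have hVf : (P.extremePoints ℝ).Finite := hAf.subset hVA
  have hLf := finite_inter_latticePoints hcpt.isBounded
  have hPV : P = convexHull ℝ (P.extremePoints ℝ) := by
    rw [← (hVf.isClosed_convexHull ℝ).closure_eq, closure_convexHull_extremePoints hcpt hconv]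
  refine ⟨hVf.toFinset, hLf.toFinset, hVf.coe_toFinset, ?_, ?_, hLf.coe_toFinset, ?_⟩
  · rwa [hVf.coe_toFinset]
  · rw [hVf.coe_toFinset, ← affineSpan_convexHull, ← hPV, hspan]
  · rw [← Finset.coe_subset, hVf.coe_toFinset, hLf.coe_toFinset]
    exact fun x hx => ⟨extremePoints_subset hx, hAl (hVA hx)⟩

/-- The number of points of `A` in the interior of `P`. -/
noncomputable def interiorCount (P : Set (EuclideanSpace ℝ (Fin d)))
    (A : Finset (EuclideanSpace ℝ (Fin d))) : ℕ := (A.filter fun x => x ∈ interior P).card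

/-- The inequality records a gain of at least `d` cells per new interior point and no loss at
boundary points, written without subtraction. -/
lemma IsTri.exists_union {P : Set (EuclideanSpace ℝ (Fin d))}
    {A : Finset (EuclideanSpace ℝ (Fin d))}
    {T : Finset (Finset (EuclideanSpace ℝ (Fin d)))} (hT : IsTri (A : Set _) T)
    (hA : convexHull ℝ (A : Set _) = P)
    (hfin : Module.finrank ℝ (vectorSpan ℝ (A : Set (EuclideanSpace ℝ (Fin d)))) = d)
    (B : Finset (EuclideanSpace ℝ (Fin d))) (hB : (B : Set _) ⊆ P) :
    ∃ T' : Finset (Finset (EuclideanSpace ℝ (Fin d))),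
      IsTri ((A ∪ B : Finset (EuclideanSpace ℝ (Fin d))) : Set _) T' ∧
      (∀ t' ∈ T', ∃ t ∈ T, convexHull ℝ (t' : Set (EuclideanSpace ℝ (Fin d))) ⊆
        convexHull ℝ (t : Set (EuclideanSpace ℝ (Fin d)))) ∧
      T.card + d * interiorCount P (A ∪ B) ≤ T'.card + d * interiorCount P A := by
  induction B using Finset.induction_on with
  | empty => exact ⟨T, by simpa using hT, fun t ht => ⟨t, ht, le_rfl⟩, by simp⟩
  | insert b B hb ih =>
    rw [Finset.coe_insert, Set.insert_subset_iff] at hB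
    obtain ⟨T', hT', href, hcard⟩ := ih hB.2
    by_cases hbA : b ∈ A ∪ B
    · rw [Finset.union_insert, Finset.insert_eq_of_mem hbA]
      exact ⟨T', hT', href, hcard⟩
    · have hAB : convexHull ℝ ((A ∪ B : Finset (EuclideanSpace ℝ (Fin d))) : Set _) = P := by
        apply Set.Subset.antisymm
        · refine convexHull_min ?_ (hA ▸ convex_convexHull ℝ _)
          rw [Finset.coe_union]
          exact Set.union_subset (hA ▸ subset_convexHull ℝ _) hB.2
        · conv_lhs => rw [← hA]
          exact convexHull_mono (by simp)
      have hfin' : Module.finrank ℝ (vectorSpan ℝ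
          ((A ∪ B : Finset (EuclideanSpace ℝ (Fin d))) : Set (EuclideanSpace ℝ (Fin d)))) = d := by
        rw [← vectorSpan_convexHull, hAB, ← hA, vectorSpan_convexHull, hfin]
      obtain ⟨T'', hT'', href', h1, h2⟩ := hT'.exists_insert (w := b) (by rw [hAB]; exact hB.1)
        (by exact_mod_cast hbA)
      rw [hAB, hfin'] at h2
      refine ⟨T'', ?_, fun t'' ht'' => ?_, ?_⟩
      · rw [Finset.union_insert, Finset.coe_insert]; exact hT''
      · obtain ⟨t', ht', hsub⟩ := href' t'' ht''
        obtain ⟨t, ht, hsub'⟩ := href t' ht'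
        exact ⟨t, ht, hsub.trans hsub'⟩
      · rw [Finset.union_insert]
        by_cases hbi : b ∈ interior P
        · have h3 := h2 (interior_subset_intrinsicInterior hbi)
          have h4 : interiorCount P (insert b (A ∪ B)) = interiorCount P (A ∪ B) + 1 := by
            rw [interiorCount, Finset.filter_insert, if_pos hbi, Finset.card_insert_of_notMem
              fun h => hbA (Finset.mem_of_mem_filter _ h), interiorCount]
          rw [h4]; linarith
        · have h4 : interiorCount P (insert b (A ∪ B)) = interiorCount P (A ∪ B) := by
            rw [interiorCount, Finset.filter_insert, if_neg hbi, interiorCount]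
          rw [h4]; linarith

lemma IsTri.isLatticeTriangulation {P : Set (EuclideanSpace ℝ (Fin d))}
    {V L A : Finset (EuclideanSpace ℝ (Fin d))} (hV : (V : Set _) = P.extremePoints ℝ)
    (hL : (L : Set _) = P ∩ latticePoints d) (hVA : V ⊆ A) (hAL : A ⊆ L)
    {T : Finset (Finset (EuclideanSpace ℝ (Fin d)))} (hT : IsTri (A : Set _) T) :
    IsLatticeTriangulation P T :=
  ⟨A, hV ▸ Finset.coe_subset.2 hVA, hL ▸ Finset.coe_subset.2 hAL, hT.isTriangulation⟩

/-- A triangulation can be refined to a full one in any number of steps not exceeding the number of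
missing lattice points. -/
lemma exists_refinement_sequence {P : Set (EuclideanSpace ℝ (Fin d))}
    {V L : Finset (EuclideanSpace ℝ (Fin d))} (hV : (V : Set _) = P.extremePoints ℝ)
    (hP : P = convexHull ℝ (V : Set _))
    (hspan : affineSpan ℝ (V : Set (EuclideanSpace ℝ (Fin d))) = ⊤)
    (hL : (L : Set _) = P ∩ latticePoints d) (n : ℕ) :
    ∀ (A : Finset (EuclideanSpace ℝ (Fin d))) (T : Finset (Finset (EuclideanSpace ℝ (Fin d)))),
      V ⊆ A → A ⊆ L → IsTri (A : Set _) T → n ≤ (L \ A).card → (n = 0 → A = L) →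
      ∃ S : ℕ → Finset (Finset (EuclideanSpace ℝ (Fin d))), S 0 = T ∧
        (∀ i ≤ n, IsLatticeTriangulation P (S i)) ∧
        (∀ i < n, IsRefinement P (S i) (S (i + 1))) ∧ IsTri (L : Set _) (S n) ∧
        T.card + d * interiorCount P L ≤ (S n).card + d * interiorCount P A := by
  have step : ∀ (A B : Finset (EuclideanSpace ℝ (Fin d)))
      (T : Finset (Finset (EuclideanSpace ℝ (Fin d)))), V ⊆ A → A ⊂ B → B ⊆ L →
      IsTri (A : Set _) T → ∃ T', IsTri (B : Set _) T' ∧ IsRefinement P T T' ∧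
        T.card + d * interiorCount P B ≤ T'.card + d * interiorCount P A := by
    intro A B T hVA hAB hBL hT
    have hLP : (L : Set _) ⊆ P := by rw [hL]; exact Set.inter_subset_left
    have hA : convexHull ℝ (A : Set _) = P := by
      apply Set.Subset.antisymm
      · refine convexHull_min ((Finset.coe_subset.2 (hAB.1.trans hBL)).trans hLP) ?_
        rw [hP]; exact convex_convexHull ℝ _
      · conv_lhs => rw [hP]
        exact convexHull_mono (Finset.coe_subset.2 hVA)
    have hfin : Module.finrank ℝ (vectorSpan ℝ (A : Set (EuclideanSpace ℝ (Fin d)))) = d := by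
      rw [← vectorSpan_convexHull, hA, hP, vectorSpan_convexHull, ← direction_affineSpan, hspan,
        AffineSubspace.direction_top, finrank_top, finrank_euclideanSpace_fin]
    obtain ⟨T', hT', href, hcard⟩ := hT.exists_union hA hfin B
      ((Finset.coe_subset.2 hBL).trans hLP)
    rw [Finset.union_eq_right.2 hAB.1] at hT' hcard
    refine ⟨T', hT', ⟨hT.isLatticeTriangulation hV hL hVA (hAB.1.trans hBL),
      hT'.isLatticeTriangulation hV hL (hVA.trans hAB.1) hBL, ?_, href⟩, hcard⟩
    rw [vertexSet, vertexSet, hT.iUnion_vertices, hT'.iUnion_vertices]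
    exact Finset.coe_ssubset.2 hAB
  induction n with
  | zero =>
    intro A T hVA hAL hT _ h0
    have := h0 rfl
    subst this
    exact ⟨fun _ => T, rfl, fun _ _ => hT.isLatticeTriangulation hV hL hVA hAL,
      fun i hi => absurd hi (Nat.not_lt_zero i), hT, le_rfl⟩
  | succ n ih =>
    intro A T hVA hAL hT hn _
    -- Each step adds one point, except the last, which takes all that remain.
    obtain ⟨B, hAB, hBL, hBn, hB0⟩ : ∃ B, A ⊂ B ∧ B ⊆ L ∧ n ≤ (L \ B).card ∧ (n = 0 → B = L) := by
      rcases Nat.eq_zero_or_pos n with rfl | hn0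
      · refine ⟨L, ⟨hAL, fun h => ?_⟩, Finset.Subset.refl _, Nat.zero_le _, fun _ => rfl⟩
        rw [Finset.sdiff_eq_empty_iff_subset.2 h] at hn
        simp at hn
      · obtain ⟨b, hb⟩ : (L \ A).Nonempty := Finset.card_pos.1 (by omega)
        obtain ⟨hbL, hbA⟩ := Finset.mem_sdiff.1 hb
        refine ⟨insert b A, Finset.ssubset_insert hbA, Finset.insert_subset hbL hAL, ?_,
          fun h => absurd h hn0.ne'⟩
        rw [Finset.sdiff_insert, Finset.card_erase_of_mem hb]
        omega
    obtain ⟨T', hT', href, hcard⟩ := step A B T hVA hAB hBL hT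
    obtain ⟨S, hS0, hS1, hS2, hS3, hS4⟩ := ih B T' (hVA.trans hAB.1) hBL hT' hBn hB0
    refine ⟨fun i => Nat.casesOn i T S, rfl, ?_, ?_, hS3, ?_⟩
    · rintro (_ | i) hi
      · exact href.1
      · exact hS1 i (by omega)
    · rintro (_ | i) hi
      · change IsRefinement P T (S 0)
        rwa [hS0]
      · exact hS2 i (by omega)
    · change _ ≤ (S n).card + _
      linarith

/-- The conclusion, given a suitable first triangulation. -/
lemma exists_sequence_of_start {P : Set (EuclideanSpace ℝ (Fin d))}
    {V L A : Finset (EuclideanSpace ℝ (Fin d))} (hV : (V : Set _) = P.extremePoints ℝ)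
    (hP : P = convexHull ℝ (V : Set _))
    (hspan : affineSpan ℝ (V : Set (EuclideanSpace ℝ (Fin d))) = ⊤)
    (hL : (L : Set _) = P ∩ latticePoints d) (hVi : ∀ v ∈ V, v ∉ interior P)
    {k : ℕ} (hk : interiorCount P L = k) (hVA : V ⊆ A) (hAL : A ⊆ L)
    (hAV : ∀ a ∈ A, a ∉ interior P → a ∈ V) (hAk : interiorCount P A = min k 1)
    {T : Finset (Finset (EuclideanSpace ℝ (Fin d)))} (hT : IsTri (A : Set _) T)
    (hTc : d * min k 1 + 1 ≤ T.card) :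
    ∃ (n : ℕ) (S : ℕ → Finset (Finset (EuclideanSpace ℝ (Fin d)))),
      (IsClean P → n = max k 1) ∧ (¬ IsClean P → n = max k 2) ∧
      (∀ i, 1 ≤ i → i ≤ n → IsLatticeTriangulation P (S i)) ∧
      (∀ i, 1 ≤ i → i < n → IsRefinement P (S i) (S (i + 1))) ∧ S 1 = T ∧
      IsTri (L : Set _) (S n) ∧ d * k + 1 ≤ (S n).card := by
  have hPc : IsClosed P := hP ▸ V.finite_toSet.isClosed_convexHull ℝ
  have hfr : ∀ x ∈ L, x ∉ interior P → x ∈ frontier P ∩ latticePoints d := by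
    intro x hx hxi
    rw [← Finset.mem_coe, hL] at hx
    exact ⟨⟨subset_closure hx.1, hxi⟩, hx.2⟩
  have hfrL : ∀ x ∈ frontier P ∩ latticePoints d, x ∈ L := by
    rintro x ⟨hx, hxl⟩
    rw [← Finset.mem_coe, hL]
    exact ⟨hPc.frontier_subset hx, hxl⟩
  set I := L.filter fun x => x ∈ interior P with hI
  have hIcard : (I \ A).card + min k 1 = k := by
    have h1 : I ∩ A = A.filter fun x => x ∈ interior P := by
      ext x
      simp only [hI, Finset.mem_inter, Finset.mem_filter]
      exact ⟨fun h => ⟨h.2, h.1.2⟩, fun h => ⟨⟨hAL h.1, h.2⟩, h.1⟩⟩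
    have h2 := Finset.card_sdiff_add_card_inter I A
    rw [h1] at h2
    rw [interiorCount, ← hI] at hk
    rw [interiorCount] at hAk
    omega
  -- `N` counts refinement steps, one fewer than the triangulations in the sequence.
  obtain ⟨N, h1, h2, h3, h4⟩ : ∃ N, N ≤ (L \ A).card ∧ (N = 0 → A = L) ∧
      (IsClean P → N + 1 = max k 1) ∧ (¬ IsClean P → N + 1 = max k 2) := by
    by_cases hclean : IsClean P
    · have hLA : L \ A ⊆ I \ A := by
        intro x hx
        obtain ⟨hxL, hxA⟩ := Finset.mem_sdiff.1 hx
        refine Finset.mem_sdiff.2 ⟨Finset.mem_filter.2 ⟨hxL, by_contra fun hxi => hxA (hVA ?_)⟩, hxA⟩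
        have := hfr x hxL hxi
        rw [hclean, ← hV] at this
        exact this
      have hLA' : L \ A = I \ A := hLA.antisymm (Finset.sdiff_subset_sdiff
        (Finset.filter_subset _ _) (Finset.Subset.refl _))
      refine ⟨k - min k 1, ?_, fun h0 => ?_, fun _ => by omega, fun h => absurd hclean h⟩
      · rw [hLA']; omega
      · refine hAL.antisymm (Finset.sdiff_eq_empty_iff_subset.1 ?_)
        rw [hLA', ← Finset.card_eq_zero]
        omega
    -- Vertices always are boundary lattice points, so failing to be clean means a further one. It
    -- is missing from `A` and pays for the extra step.
    · obtain ⟨x, hx, hxV⟩ : ∃ x ∈ frontier P ∩ latticePoints d, x ∉ V := by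
        by_contra hno
        push Not at hno
        refine hclean (Set.Subset.antisymm (hV ▸ hno) ?_)
        rw [← hV]
        intro v hv
        exact hfr v (hAL (hVA hv)) (hVi v hv)
      have h1 : insert x (I \ A) ⊆ L \ A := by
        refine Finset.insert_subset (Finset.mem_sdiff.2 ⟨hfrL x hx, fun hxA => ?_⟩)
          (Finset.sdiff_subset_sdiff (Finset.filter_subset _ _) (Finset.Subset.refl _))
        exact hxV (hAV x hxA hx.1.2)
      have h2 := Finset.card_le_card h1
      have hxI : x ∉ I \ A := fun h => hx.1.2 (Finset.mem_filter.1 (Finset.mem_sdiff.1 h).1).2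
      rw [Finset.card_insert_of_notMem hxI] at h2
      exact ⟨max k 2 - 1, by omega, fun h => by omega, fun h => absurd h hclean,
        fun _ => by omega⟩
  obtain ⟨S, hS0, hS1, hS2, hS3, hS4⟩ :=
    exists_refinement_sequence hV hP hspan hL N A T hVA hAL hT h1 h2
  refine ⟨N + 1, fun i => S (i - 1), h3, h4, fun i _ hi => hS1 _ (by omega), ?_, hS0, hS3, ?_⟩
  · intro i hi hin
    have := hS2 (i - 1) (by omega)
    rwa [show i - 1 + 1 = i + 1 - 1 by omega] at this
  · rw [hk, hAk] at hS4
    change _ ≤ (S N).card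
    linarith

lemma IsTri.isBasicTriangulation {P : Set (EuclideanSpace ℝ (Fin d))} (hd : 1 ≤ d)
    {V L : Finset (EuclideanSpace ℝ (Fin d))} (hV : (V : Set _) = P.extremePoints ℝ)
    (hP : P = convexHull ℝ (V : Set _)) (hL : (L : Set _) = P ∩ latticePoints d) (hVL : V ⊆ L)
    {w : EuclideanSpace ℝ (Fin d)} (hw : w ∈ interior P) (hwL : w ∈ L)
    {T : Finset (Finset (EuclideanSpace ℝ (Fin d)))}
    (hT : IsTri (insert w (V : Set (EuclideanSpace ℝ (Fin d)))) T) (hwT : ∀ s ∈ T, w ∈ s)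
    (hcard : ∀ s ∈ T, s.card = d + 1) : IsBasicTriangulation P w T := by
  refine ⟨⟨hw, ?_⟩, ?_, linkIn T w, fun F hF => ?_, fun t => ⟨fun ht => ?_, ?_⟩⟩
  · rw [← Finset.mem_coe, hL] at hwL
    exact hwL.2
  · exact IsTri.isLatticeTriangulation (A := insert w V) hV hL (Finset.subset_insert _ _)
      (Finset.insert_subset hwL hVL) (by rwa [Finset.coe_insert])
  · exact (isTri_linkIn hV hP hw hT hwT hcard hF).isTriangulation
  · obtain ⟨F, hF, hs⟩ := exists_facet_of_mem hd hP hw hT hwT hcard ht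
    refine ⟨F, hF, _, hs, ?_⟩
    rw [← Finset.coe_insert, Finset.insert_erase (hwT t ht)]
  · rintro ⟨F, hF, s, hs, hts⟩
    obtain ⟨⟨r, hr, rfl⟩, -⟩ := mem_linkIn.1 hs
    rw [← Finset.coe_insert, Finset.insert_erase (hwT r hr), Finset.coe_inj] at hts
    rwa [hts]

end Main

end LatticeTriang

/-! ### Assembly of the theorem. -/

theorem mainTheorem7 (d : ℕ) (hd : 1 ≤ d) (P : Set (EuclideanSpace ℝ (Fin d)))
    (hP : LatticeTriang.IsLatticePolytope P) (k : ℕ)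
    (hk : (interior P ∩ LatticeTriang.latticePoints d).encard = (k : ℕ∞)) :
    (∃ (n : ℕ) (T : ℕ → Finset (Finset (EuclideanSpace ℝ (Fin d)))),
      (LatticeTriang.IsClean P → n = max k 1) ∧
      (¬ LatticeTriang.IsClean P → n = max k 2) ∧
      (∀ i, 1 ≤ i → i ≤ n → LatticeTriang.IsLatticeTriangulation P (T i)) ∧
      (∀ i, 1 ≤ i → i < n → LatticeTriang.IsRefinement P (T i) (T (i + 1))) ∧
      (1 ≤ k → ∃ w, LatticeTriang.IsBasicTriangulation P w (T 1)) ∧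
      (k = 0 → LatticeTriang.IsTriangulation (P.extremePoints ℝ) (T 1)) ∧
      LatticeTriang.IsFullTriangulation P (T n) ∧
      d * k + 1 ≤ (T n).card) ∧
    ((d : ℝ) * (k : ℝ) + 1) / (Nat.factorial d : ℝ) ≤ (MeasureTheory.volume P).toReal := by
  classical
  obtain ⟨V, L, hV, hPV, hspan, hL, hVL⟩ := hP.exists_finset
  have hVcard : 2 ≤ V.card := by
    have := LatticeTriang.card_le_of_affineSpan_eq_top hspan
    rw [finrank_euclideanSpace_fin] at this
    omega
  have hVP : (V : Set _) ⊆ P := by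
    rw [hV]; exact extremePoints_subset
  have hVi : ∀ v ∈ V, v ∉ interior P := by
    have : Nonempty (Fin d) := ⟨⟨0, hd⟩⟩
    exact fun v hv hvi => Set.disjoint_left.1 (disjoint_interior_extremePoints P) hvi
      (hV ▸ Finset.mem_coe.2 hv)
  have hLint : interior P ∩ LatticeTriang.latticePoints d =
      ((L.filter fun x => x ∈ interior P : Finset _) : Set _) := by
    ext x
    have : x ∈ L ↔ x ∈ P ∩ LatticeTriang.latticePoints d := by rw [← hL]; rfl
    rw [Finset.coe_filter, Set.mem_ofPred_eq, this]
    exact ⟨fun h => ⟨⟨interior_subset h.1, h.2⟩, h.1⟩, fun h => ⟨h.2, h.1.2⟩⟩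
  have hLk : LatticeTriang.interiorCount P L = k := by
    rw [hLint, Set.encard_coe_eq_coe_finsetCard] at hk
    rw [LatticeTriang.interiorCount]
    convert ENat.natCast_inj.1 hk
  have hVc : LatticeTriang.interiorCount P V = 0 := by
    rw [LatticeTriang.interiorCount, Finset.card_eq_zero, Finset.filter_eq_empty_iff]
    exact fun v hv => hVi v hv
  have hcardT : ∀ {A : Finset (EuclideanSpace ℝ (Fin d))}
      {T : Finset (Finset (EuclideanSpace ℝ (Fin d)))}, V ⊆ A →
      LatticeTriang.IsTri (A : Set _) T → ∀ s ∈ T, s.card = d + 1 := by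
    intro A T hVA hT s hs
    have hA : affineSpan ℝ (A : Set (EuclideanSpace ℝ (Fin d))) = ⊤ :=
      top_unique (hspan ▸ affineSpan_mono ℝ (Finset.coe_subset.2 hVA))
    rw [hT.card_eq s hs, ← direction_affineSpan, hA, AffineSubspace.direction_top, finrank_top,
      finrank_euclideanSpace_fin]
  obtain ⟨A, T, hVA, hAL, hAV, hAk, hT, hTc, hbasic, hzero⟩ :
      ∃ (A : Finset (EuclideanSpace ℝ (Fin d))) (T : Finset (Finset (EuclideanSpace ℝ (Fin d)))),
        V ⊆ A ∧ A ⊆ L ∧ (∀ a ∈ A, a ∉ interior P → a ∈ V) ∧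
        LatticeTriang.interiorCount P A = min k 1 ∧ LatticeTriang.IsTri (A : Set _) T ∧
        d * min k 1 + 1 ≤ T.card ∧ (1 ≤ k → ∃ w, LatticeTriang.IsBasicTriangulation P w T) ∧
        (k = 0 → LatticeTriang.IsTriangulation (P.extremePoints ℝ) T) := by
    -- Without interior lattice points an arbitrary vertex is pulled; otherwise an interior lattice
    -- point is.
    rcases Nat.eq_zero_or_pos k with hk0 | hk0
    · obtain ⟨w, hw⟩ : V.Nonempty := Finset.card_pos.1 (by omega)
      obtain ⟨T, hT, hwT⟩ := LatticeTriang.exists_isTri_pulling hspan hw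
        (fun a ha _ => by rw [← hPV, ← hV]; exact ha)
      have hTne : T.Nonempty := by
        obtain ⟨s, hs, -⟩ := hT.exists_carrier (subset_convexHull ℝ _ hw)
        exact ⟨s, hs⟩
      refine ⟨V, T, Finset.Subset.refl _, hVL, fun a ha _ => ha, by rw [hVc, hk0]; rfl, hT, ?_,
        fun h => by omega, fun _ => hV ▸ hT.isTriangulation⟩
      rw [hk0]
      simpa using hTne
    · obtain ⟨w, hw⟩ : (L.filter fun x => x ∈ interior P).Nonempty := by
        rw [← Finset.card_pos]
        rw [LatticeTriang.interiorCount] at hLk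
        convert hk0
      obtain ⟨hwL, hwi⟩ := Finset.mem_filter.1 hw
      have hwV : w ∉ V := fun h => hVi w h hwi
      have hA : convexHull ℝ ((insert w V : Finset (EuclideanSpace ℝ (Fin d))) : Set _) = P := by
        apply Set.Subset.antisymm
        · refine convexHull_min ?_ (by rw [hPV]; exact convex_convexHull ℝ _)
          rw [Finset.coe_insert]
          exact Set.insert_subset (interior_subset hwi) hVP
        · conv_lhs => rw [hPV]
          exact convexHull_mono (by simp)
      have hspanA : affineSpan ℝ ((insert w V : Finset (EuclideanSpace ℝ (Fin d))) :
          Set (EuclideanSpace ℝ (Fin d))) = ⊤ :=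
        top_unique (hspan ▸ affineSpan_mono ℝ (by simp))
      obtain ⟨T, hT, hwT⟩ := LatticeTriang.exists_isTri_pulling hspanA (Finset.mem_insert_self w V)
        (fun a ha haw => by
          rw [hA, ← hV]; exact (Finset.mem_insert.1 ha).resolve_left haw)
      have hTd := hcardT (Finset.subset_insert w V) hT
      have hk1 : min k 1 = 1 := by omega
      refine ⟨insert w V, T, Finset.subset_insert _ _, Finset.insert_subset hwL hVL,
        fun a ha hai => (Finset.mem_insert.1 ha).resolve_left fun h => hai (h ▸ hwi), ?_, hT, ?_,
        fun _ => ⟨w, LatticeTriang.IsTri.isBasicTriangulation hd hV hPV hL hVL hwi hwL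
          (by rwa [← Finset.coe_insert]) hwT hTd⟩, fun h => by omega⟩
      · rw [hk1, LatticeTriang.interiorCount, Finset.filter_insert, if_pos hwi,
          Finset.card_insert_of_notMem fun h => hwV (Finset.mem_of_mem_filter _ h)]
        rw [LatticeTriang.interiorCount] at hVc
        omega
      · obtain ⟨s, hs, -⟩ := hT.exists_carrier
          (subset_convexHull ℝ _ (Finset.mem_coe.2 (Finset.mem_insert_self w V)))
        -- The star bound at the face `{w}` reads `d + 2 ≤ m + 1`, which gives the `d + 1` initial
        -- cells.
        have h1 := hT.le_card_star hs (F := {w}) (w := w) (by simpa using hwT s hs)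
          (by simp) (by rw [hA]; exact interior_subset_intrinsicInterior hwi)
        rw [← direction_affineSpan, hspanA, AffineSubspace.direction_top, finrank_top,
          finrank_euclideanSpace_fin, Finset.card_singleton] at h1
        have h2 := Finset.card_filter_le T fun s => {w} ⊆ s
        rw [hk1]
        omega
  obtain ⟨n, S, h1, h2, h3, h4, h5, h6, h7⟩ := LatticeTriang.exists_sequence_of_start hV hPV hspan
    hL hVi hLk hVA hAL hAV hAk hT hTc
  refine ⟨⟨n, S, h1, h2, h3, h4, by rwa [h5], by rwa [h5],
    ⟨h6.isLatticeTriangulation hV hL hVL (Finset.Subset.refl _), ?_⟩, h7⟩, ?_⟩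
  · rw [LatticeTriang.vertexSet, h6.iUnion_vertices, hL]
  · have h8 := LatticeTriang.card_div_factorial_le_volume h6
      (by rw [hL]; exact Set.inter_subset_right) (hcardT hVL h6)
    have h9 : convexHull ℝ (L : Set (EuclideanSpace ℝ (Fin d))) = P := by
      apply Set.Subset.antisymm
      · refine convexHull_min (by rw [hL]; exact Set.inter_subset_left) ?_
        rw [hPV]; exact convex_convexHull ℝ _
      · conv_lhs => rw [hPV]
        exact convexHull_mono (Finset.coe_subset.2 hVL)
    rw [h9] at h8
    refine le_trans ?_ h8
    gcongr
    exact_mod_cast h7
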